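/- Let $I=(-1,1)$ and let $\kappa,\nu>0$. Let $L^2(I)$, $H^1_0(I)$, $H^2(I)$ be the usual spaces of real-valued (or of complex-valued) functions on $I$; equip $H^1_0(I)$ with the inner product $(u,w)_{H^1_0}=\kappa\,(u',w')_{L^2}$, and put $\mathcal H=H^1_0(I)\times L^2(I)$. Let $$U=\begin{pmatrix}0&\mathcal I\\ \kappa\,\frac{d^2}{dx^2}&-\nu\,\mathcal I\end{pmatrix},\qquad D(U)=(H^2(I)\cap H^1_0(I))\times H^1_0(I),$$ and equip $D(U)$ with the inner product $$((u_1,v_1),(u_2,v_2))_{D(U)}=(u_1'',u_2'')_{L^2}+(u_1,u_2)_{H^1_0}+(v_1,v_2)_{H^1_0}.$$ Then $U$ is a closed linear operator in $\mathcal H$, and the following hold. 1. For $n\ge 1$ put $\theta_n=n^2\pi^2\kappa-\nu^2$. Let $\theta=-\nu/2$ if $\theta_n\ge 0$ for all $n\ge1$, and let $$\theta=\max_{n\ge 1:\ \theta_n<0}\Big\{-\frac{\nu}{2}+\frac{\sqrt{\nu^2-n^2\pi^2\kappa}}{2}\Big\}$$ otherwise. Then the resolvent set satisfies $\rho(U)\supset\{\lambda:\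 \mathrm{Re}\,\lambda>\theta\}$. In particular, the imaginary axis is contained in $\rho(U)$. 2. $U$ is the generator of a strongly continuous contraction semigroup $T(t)$, $t\ge0$, on $\mathcal H$. If $T_0>0$, $J=[0,T_0]$, $F_0\in D(U)$ and $F_1\in C(J,D(U))$, then $$V(t)=T(t)F_0+\int_0^tT(t-s)F_1(s)\,ds$$ is well defined, belongs to $C(J,D(U))$, and satisfies $V_t=UV(t)+F_1(t)$ for $0<t\le T_0$ (derivative in $\mathcal H$, one-sided at $t=T_0$) and $V(0)=F_0$. 3. For $t\ge 0$, $T(t)$ maps $D(U)$ into itself and restricts to a bounded operator on $D(U)$, and the operator norm $\|T(t)\|_{D(U)}$ of this restriction, with respect to the norm of $D(U)$, tends to $0$ as $t\to\infty$. In particular, there is a number $\omega$ with $\|T(t)\|_{D(U)}\le\omega$ for all $t\ge0$. -/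

import Mathlib

noncomputable section
namespace DampedWave

open MeasureTheory Set Filter Topology
open scoped ContDiff

/-- The space `L²(I)` of `𝕜`-valued functions on the interval `I = (-1, 1)`. -/
abbrev L2 (𝕜 : Type*) [RCLike 𝕜] : Type _ :=
  Lp 𝕜 2 (volume.restrict (Ioo (-1 : ℝ) 1))

/-- `φ` is a test function on `I`, i.e. an element of `C_c^∞(I)`. -/
structure IsTestFunction {𝕜 : Type*} [RCLike 𝕜] (φ : ℝ → 𝕜) : Prop where
  smooth : ContDiff ℝ ∞ φ
  compact : HasCompactSupport φ
  support : tsupport φ ⊆ Ioo (-1 : ℝ) 1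

/-- `g` is the weak derivative of `u` on `I`. -/
def HasWeakDeriv {𝕜 : Type*} [RCLike 𝕜] (u g : L2 𝕜) : Prop :=
  ∀ φ : ℝ → 𝕜, IsTestFunction φ →
    ∫ x in Ioo (-1 : ℝ) 1, u x * deriv φ x = - ∫ x in Ioo (-1 : ℝ) 1, g x * φ x

section Basic
variable {𝕜 : Type*} [RCLike 𝕜]

theorem IsTestFunction.deriv_continuous {φ : ℝ → 𝕜} (h : IsTestFunction φ) :
    Continuous (deriv φ) := h.smooth.continuous_deriv (by simp)

theorem IsTestFunction.add {φ ψ : ℝ → 𝕜} (h : IsTestFunction φ) (h' : IsTestFunction ψ) :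
    IsTestFunction (φ + ψ) :=
  ⟨h.smooth.add h'.smooth, h.compact.add h'.compact,
    (tsupport_add φ ψ).trans (union_subset h.support h'.support)⟩

theorem IsTestFunction.smul {φ : ℝ → 𝕜} (h : IsTestFunction φ) (c : 𝕜) :
    IsTestFunction (c • φ) :=
  ⟨h.smooth.const_smul c, h.compact.mono (Function.support_const_smul_subset c φ),
    (closure_mono (Function.support_const_smul_subset c φ)).trans h.support⟩

theorem IsTestFunction.zero : IsTestFunction (0 : ℝ → 𝕜) :=
  ⟨contDiff_const, HasCompactSupport.zero, by simp [tsupport]⟩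

theorem integrable_mul_test (u : L2 𝕜) {ψ : ℝ → 𝕜} (hc : Continuous ψ)
    (hs : HasCompactSupport ψ) :
    Integrable (fun x => u x * ψ x) (volume.restrict (Ioo (-1 : ℝ) 1)) :=
  MemLp.integrable_mul (Lp.memLp u)
    ((hc.memLp_of_hasCompactSupport hs (p := 2) (μ := volume)).restrict _)

theorem HasWeakDeriv.add {u g u' g' : L2 𝕜} (h : HasWeakDeriv u g) (h' : HasWeakDeriv u' g') :
    HasWeakDeriv (u + u') (g + g') := by
  intro φ hφ
  have e1 : ∫ x in Ioo (-1 : ℝ) 1, (u + u') x * deriv φ x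
      = ∫ x in Ioo (-1 : ℝ) 1, (u x * deriv φ x + u' x * deriv φ x) := by
    refine integral_congr_ae ?_
    filter_upwards [Lp.coeFn_add u u'] with x hx
    rw [hx, Pi.add_apply, add_mul]
  have e2 : ∫ x in Ioo (-1 : ℝ) 1, (g + g') x * φ x
      = ∫ x in Ioo (-1 : ℝ) 1, (g x * φ x + g' x * φ x) := by
    refine integral_congr_ae ?_
    filter_upwards [Lp.coeFn_add g g'] with x hx
    rw [hx, Pi.add_apply, add_mul]
  rw [e1, e2, integral_add (integrable_mul_test u hφ.deriv_continuous hφ.compact.deriv)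
    (integrable_mul_test u' hφ.deriv_continuous hφ.compact.deriv),
    integral_add (integrable_mul_test g hφ.smooth.continuous hφ.compact)
    (integrable_mul_test g' hφ.smooth.continuous hφ.compact), h φ hφ, h' φ hφ]
  ring

theorem HasWeakDeriv.smul {u g : L2 𝕜} (c : 𝕜) (h : HasWeakDeriv u g) :
    HasWeakDeriv (c • u) (c • g) := by
  intro φ hφ
  have e1 : ∫ x in Ioo (-1 : ℝ) 1, (c • u) x * deriv φ x
      = ∫ x in Ioo (-1 : ℝ) 1, c * (u x * deriv φ x) := by
    refine integral_congr_ae ?_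
    filter_upwards [Lp.coeFn_smul c u] with x hx
    rw [hx, Pi.smul_apply, smul_eq_mul, mul_assoc]
  have e2 : ∫ x in Ioo (-1 : ℝ) 1, (c • g) x * φ x
      = ∫ x in Ioo (-1 : ℝ) 1, c * (g x * φ x) := by
    refine integral_congr_ae ?_
    filter_upwards [Lp.coeFn_smul c g] with x hx
    rw [hx, Pi.smul_apply, smul_eq_mul, mul_assoc]
  rw [e1, e2, integral_const_mul, integral_const_mul, h φ hφ, mul_neg]

theorem hasWeakDeriv_zero : HasWeakDeriv (0 : L2 𝕜) 0 := by
  intro φ _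
  have e : ∀ ψ : ℝ → 𝕜, ∫ x in Ioo (-1 : ℝ) 1, (0 : L2 𝕜) x * ψ x = 0 := by
    intro ψ
    refine integral_eq_zero_of_ae ?_
    filter_upwards [Lp.coeFn_zero 𝕜 2 (volume.restrict (Ioo (-1 : ℝ) 1))] with x hx
    rw [hx]; simp
  rw [e, e, neg_zero]

theorem HasWeakDeriv.unique {u g g' : L2 𝕜} (h : HasWeakDeriv u g) (h' : HasWeakDeriv u g') :
    g = g' := by
  have hd : HasWeakDeriv (0 : L2 𝕜) (g - g') := by
    have := h.add (h'.smul (-1))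
    simpa [sub_eq_add_neg] using this
  rw [← sub_eq_zero]
  have hloc : LocallyIntegrableOn (g - g' : L2 𝕜) (Ioo (-1 : ℝ) 1) volume :=
    IntegrableOn.locallyIntegrableOn
      ((Lp.memLp (g - g')).integrable (by norm_num))
  have key := isOpen_Ioo.ae_eq_zero_of_integral_contDiff_smul_eq_zero hloc (by
    intro ψ hψ hc hs
    have ht : IsTestFunction (fun x => ((ψ x : ℝ) : 𝕜)) :=
      ⟨(RCLike.ofRealCLM (K := 𝕜)).contDiff.comp hψ, hc.comp_left (by simp),
        (tsupport_comp_subset (by simp) ψ).trans hs⟩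
    have h1 := hd _ ht
    have h0 : ∫ x in Ioo (-1 : ℝ) 1, (0 : L2 𝕜) x * deriv (fun x => ((ψ x : ℝ) : 𝕜)) x = 0 := by
      refine integral_eq_zero_of_ae ?_
      filter_upwards [Lp.coeFn_zero 𝕜 2 (volume.restrict (Ioo (-1 : ℝ) 1))] with x hx
      rw [hx]; simp
    rw [h0, eq_comm, neg_eq_zero] at h1
    rw [← h1, ← setIntegral_eq_integral_of_forall_compl_eq_zero (s := Ioo (-1 : ℝ) 1)]
    · refine integral_congr_ae (Eventually.of_forall fun x => ?_)
      simp only [RCLike.real_smul_eq_coe_mul]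
      ring
    · intro x hx
      have : ψ x = 0 := by
        by_contra hne
        exact hx (hs (subset_tsupport ψ hne))
      simp [this])
  rw [Lp.eq_zero_iff_ae_eq_zero]
  exact (ae_restrict_iff' measurableSet_Ioo).2 key

end Basic

/-- The Sobolev space `H¹(I)` of the `u ∈ L²(I)` with a weak derivative in `L²(I)`. -/
def H1 (𝕜 : Type*) [RCLike 𝕜] : Submodule 𝕜 (L2 𝕜) where
  carrier := {u | ∃ g : L2 𝕜, HasWeakDeriv u g}
  add_mem' := fun ⟨g, hg⟩ ⟨g', hg'⟩ => ⟨g + g', hg.add hg'⟩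
  zero_mem' := ⟨0, hasWeakDeriv_zero⟩
  smul_mem' := fun c _ ⟨g, hg⟩ => ⟨c • g, hg.smul c⟩

/-- The weak derivative `u ↦ u'` as a linear map `H¹(I) → L²(I)`. -/
def weakDeriv (𝕜 : Type*) [RCLike 𝕜] : H1 𝕜 →ₗ[𝕜] L2 𝕜 where
  toFun u := u.2.choose
  map_add' u v := (u + v).2.choose_spec.unique (u.2.choose_spec.add v.2.choose_spec)
  map_smul' c u := (c • u).2.choose_spec.unique (u.2.choose_spec.smul c)

theorem weakDeriv_spec {𝕜 : Type*} [RCLike 𝕜] (u : H1 𝕜) :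
    HasWeakDeriv (u : L2 𝕜) (weakDeriv 𝕜 u) := u.2.choose_spec

/-- The pairs `(φ, φ')` in `L²(I) × L²(I)` for test functions `φ ∈ C_c^∞(I)`. -/
def testPairs (𝕜 : Type*) [RCLike 𝕜] : Submodule 𝕜 (L2 𝕜 × L2 𝕜) where
  carrier := {p | ∃ φ : ℝ → 𝕜, IsTestFunction φ ∧
    p.1 =ᵐ[volume.restrict (Ioo (-1 : ℝ) 1)] φ ∧
    p.2 =ᵐ[volume.restrict (Ioo (-1 : ℝ) 1)] deriv φ}
  add_mem' := by
    rintro p q ⟨φ, hφ, h1, h2⟩ ⟨ψ, hψ, h3, h4⟩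
    refine ⟨φ + ψ, hφ.add hψ, (Lp.coeFn_add _ _).trans (h1.add h3), ?_⟩
    refine ((Lp.coeFn_add _ _).trans (h2.add h4)).trans (Eventually.of_forall fun x => ?_)
    exact (deriv_add (hφ.smooth.differentiable (by simp) x)
      (hψ.smooth.differentiable (by simp) x)).symm
  zero_mem' := ⟨0, IsTestFunction.zero, Lp.coeFn_zero _ _ _, by
    refine (Lp.coeFn_zero _ _ _).trans (Eventually.of_forall fun x => ?_)
    exact (deriv_const x (0 : 𝕜)).symm⟩
  smul_mem' := by
    rintro c p ⟨φ, hφ, h1, h2⟩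
    refine ⟨c • φ, hφ.smul c, (Lp.coeFn_smul _ _).trans (h1.const_smul c), ?_⟩
    refine ((Lp.coeFn_smul _ _).trans (h2.const_smul c)).trans (Eventually.of_forall fun x => ?_)
    exact (deriv_const_smul c (hφ.smooth.differentiable (by simp) x)).symm

/-- `H¹₀(I)`, the closure of `C_c^∞(I)` in `H¹(I)`: the `u ∈ H¹(I)` for which `(u, u')` is a limit
in `L²(I) × L²(I)` of pairs `(φ, φ')` with `φ ∈ C_c^∞(I)`. -/
def H10sub (𝕜 : Type*) [RCLike 𝕜] : Submodule 𝕜 (H1 𝕜) :=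
  (testPairs 𝕜).topologicalClosure.comap ((H1 𝕜).subtype.prod (weakDeriv 𝕜))

/-- `H²(I)`: the `u ∈ H¹(I)` with `u' ∈ H¹(I)`. -/
def H2sub (𝕜 : Type*) [RCLike 𝕜] : Submodule 𝕜 (H1 𝕜) :=
  (H1 𝕜).comap (weakDeriv 𝕜)

/-- The second weak derivative `u ↦ u''` as a linear map `H²(I) → L²(I)`. -/
def weakDeriv₂ (𝕜 : Type*) [RCLike 𝕜] : H2sub 𝕜 →ₗ[𝕜] L2 𝕜 :=
  weakDeriv 𝕜 ∘ₗ ((weakDeriv 𝕜 ∘ₗ (H2sub 𝕜).subtype).codRestrict (H1 𝕜) fun u => u.2)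

theorem test_enorm_le {𝕜 : Type*} [RCLike 𝕜] {φ : ℝ → 𝕜} (hφ : IsTestFunction φ) {x : ℝ}
    (hx : x ∈ Ioo (-1 : ℝ) 1) :
    ‖φ x‖ₑ ≤ eLpNorm (deriv φ) 1 (volume.restrict (Ioo (-1 : ℝ) 1)) := by
  have h0 : φ (-1) = 0 := by
    by_contra hne
    exact absurd (hφ.support (subset_tsupport φ hne)) (by simp)
  have h1 : ∫ y in (-1 : ℝ)..x, deriv φ y = φ x := by
    rw [intervalIntegral.integral_deriv_eq_sub
      (fun y _ => hφ.smooth.differentiable (by simp) y)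
      (hφ.deriv_continuous.intervalIntegrable _ _), h0, sub_zero]
  rw [← h1, intervalIntegral.integral_of_le hx.1.le, eLpNorm_one_eq_lintegral_enorm]
  refine (enorm_integral_le_lintegral_enorm _).trans (lintegral_mono_set ?_)
  exact fun y hy => ⟨hy.1, hy.2.trans_lt hx.2⟩

/-- The Poincaré inequality for test functions. -/
theorem poincare_test {𝕜 : Type*} [RCLike 𝕜] {p : L2 𝕜 × L2 𝕜} (hp : p ∈ testPairs 𝕜) :
    ‖p.1‖ ≤ 2 * ‖p.2‖ := by
  obtain ⟨φ, hφ, h1, h2⟩ := hp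
  have hμ : (volume.restrict (Ioo (-1 : ℝ) 1)) univ = 2 := by
    rw [Measure.restrict_apply_univ, Real.volume_Ioo]; norm_num
  have e1 : eLpNorm (deriv φ) 1 (volume.restrict (Ioo (-1 : ℝ) 1)) ≤
      eLpNorm (deriv φ) 2 (volume.restrict (Ioo (-1 : ℝ) 1)) * 2 ^ (1 / 2 : ℝ) := by
    have := eLpNorm_le_eLpNorm_mul_rpow_measure_univ (p := 1) (q := 2)
      (μ := volume.restrict (Ioo (-1 : ℝ) 1)) (by norm_num)
      hφ.deriv_continuous.aestronglyMeasurable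
    rw [hμ] at this
    convert this using 3
    norm_num
  have e2 : eLpNorm φ 2 (volume.restrict (Ioo (-1 : ℝ) 1)) ≤
      eLpNorm (deriv φ) 1 (volume.restrict (Ioo (-1 : ℝ) 1)) * 2 ^ (1 / 2 : ℝ) := by
    have := eLpNorm_le_eLpNorm_mul_rpow_measure_univ (p := 2) (q := ⊤)
      (μ := volume.restrict (Ioo (-1 : ℝ) 1)) (by norm_num)
      hφ.smooth.continuous.aestronglyMeasurable
    rw [hμ] at this
    have htop : eLpNorm φ ⊤ (volume.restrict (Ioo (-1 : ℝ) 1)) ≤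
        eLpNorm (deriv φ) 1 (volume.restrict (Ioo (-1 : ℝ) 1)) := by
      rw [eLpNorm_exponent_top]
      refine essSup_le_of_ae_le _ ?_
      filter_upwards [ae_restrict_mem measurableSet_Ioo] with x hx using test_enorm_le hφ hx
    have hexp : (1 / ENNReal.toReal 2 - 1 / (⊤ : ENNReal).toReal) = (1 / 2 : ℝ) := by norm_num
    rw [hexp] at this
    exact this.trans (mul_le_mul_left htop _)
  have e3 : (2 : ENNReal) ^ (1 / 2 : ℝ) * 2 ^ (1 / 2 : ℝ) = 2 := by
    rw [← ENNReal.rpow_add _ _ (by norm_num) (by norm_num)]; norm_num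
  have e4 : eLpNorm φ 2 (volume.restrict (Ioo (-1 : ℝ) 1)) ≤
      2 * eLpNorm (deriv φ) 2 (volume.restrict (Ioo (-1 : ℝ) 1)) := by
    refine (e2.trans (mul_le_mul_left e1 _)).trans (le_of_eq ?_)
    rw [mul_assoc, e3, mul_comm]
  rw [Lp.norm_def, Lp.norm_def, eLpNorm_congr_ae h1]
  have hfin := Lp.eLpNorm_ne_top p.2
  rw [← eLpNorm_congr_ae h2] at e4
  have := ENNReal.toReal_mono (ENNReal.mul_ne_top (by norm_num) hfin) e4
  simpa using this

theorem poincare_closure {𝕜 : Type*} [RCLike 𝕜] (p : L2 𝕜 × L2 𝕜)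
    (hp : p ∈ (testPairs 𝕜).topologicalClosure) : ‖p.1‖ ≤ 2 * ‖p.2‖ := by
  have hcl : IsClosed {p : L2 𝕜 × L2 𝕜 | ‖p.1‖ ≤ 2 * ‖p.2‖} :=
    isClosed_le continuous_fst.norm (continuous_const.mul continuous_snd.norm)
  have hsub : closure (testPairs 𝕜 : Set (L2 𝕜 × L2 𝕜)) ⊆ {p | ‖p.1‖ ≤ 2 * ‖p.2‖} :=
    closure_minimal (fun _ hq => poincare_test hq) hcl
  exact hsub hp

/-- The Poincaré inequality in `H¹₀(I)`. -/
theorem poincare {𝕜 : Type*} [RCLike 𝕜] (u : H1 𝕜) (hu : u ∈ H10sub 𝕜) :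
    ‖(u : L2 𝕜)‖ ≤ 2 * ‖weakDeriv 𝕜 u‖ := by
  have hu' : ((u : L2 𝕜), weakDeriv 𝕜 u) ∈ (testPairs 𝕜).topologicalClosure := hu
  have := poincare_closure _ hu'
  exact this

/-- The Hilbert space `H¹₀(I)`, with inner product `κ (u', w')_{L²}`. -/
def H10 (𝕜 : Type*) [RCLike 𝕜] (_κ : ℝ) : Type _ := H10sub 𝕜

section H10
variable (𝕜 : Type*) [RCLike 𝕜] (κ : ℝ)

instance : AddCommGroup (H10 𝕜 κ) := inferInstanceAs (AddCommGroup (H10sub 𝕜))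
instance : Module 𝕜 (H10 𝕜 κ) := inferInstanceAs (Module 𝕜 (H10sub 𝕜))
instance : Module ℝ (H10 𝕜 κ) := inferInstanceAs (Module ℝ (H10sub 𝕜))
instance : IsScalarTower ℝ 𝕜 (H10 𝕜 κ) := inferInstanceAs (IsScalarTower ℝ 𝕜 (H10sub 𝕜))

/-- The inclusion `H¹₀(I) ⊆ H¹(I)`. -/
def H10.toH1 : H10 𝕜 κ →ₗ[𝕜] H1 𝕜 := (H10sub 𝕜).subtype

/-- The linear map `u ↦ √κ u'` from `H¹₀(I)` to `L²(I)`, which induces the norm of `H¹₀(I)`. -/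
def H10.gradient : H10 𝕜 κ →ₗ[𝕜] L2 𝕜 := ((√κ : ℝ) : 𝕜) • (weakDeriv 𝕜 ∘ₗ H10.toH1 𝕜 κ)

theorem H10.gradient_injective [hκ : Fact (0 < κ)] : Function.Injective (H10.gradient 𝕜 κ) := by
  rw [injective_iff_map_eq_zero]
  intro u hu
  have h1 : ((√κ : ℝ) : 𝕜) ≠ 0 := by simpa using (Real.sqrt_pos.2 hκ.out).ne'
  have h2 : weakDeriv 𝕜 (H10.toH1 𝕜 κ u) = 0 := (smul_eq_zero.1 hu).resolve_left h1
  have h5 : ‖(H10.toH1 𝕜 κ u : L2 𝕜)‖ ≤ 2 * ‖weakDeriv 𝕜 (H10.toH1 𝕜 κ u)‖ := poincare _ u.2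
  rw [h2, norm_zero, mul_zero] at h5
  have h6 : ((H10.toH1 𝕜 κ u : H1 𝕜) : L2 𝕜) = 0 := norm_le_zero_iff.1 h5
  exact Subtype.ext (Subtype.ext h6)

variable [Fact (0 < κ)]

instance : NormedAddCommGroup (H10 𝕜 κ) :=
  NormedAddCommGroup.induced _ _ (H10.gradient 𝕜 κ) (H10.gradient_injective 𝕜 κ)

instance : InnerProductSpace 𝕜 (H10 𝕜 κ) := InnerProductSpace.induced (H10.gradient 𝕜 κ)

instance : NormedSpace ℝ (H10 𝕜 κ) :=
  NormedSpace.induced ℝ _ _ ((H10.gradient 𝕜 κ).restrictScalars ℝ)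

theorem H10.inner_def (u w : H10 𝕜 κ) :
    inner 𝕜 u w =
      (κ : 𝕜) * inner 𝕜 (weakDeriv 𝕜 (H10.toH1 𝕜 κ u)) (weakDeriv 𝕜 (H10.toH1 𝕜 κ w)) := by
  change inner 𝕜 (((√κ : ℝ) : 𝕜) • weakDeriv 𝕜 (H10.toH1 𝕜 κ u))
    (((√κ : ℝ) : 𝕜) • weakDeriv 𝕜 (H10.toH1 𝕜 κ w)) = _
  rw [inner_smul_left, inner_smul_right, RCLike.conj_ofReal, ← mul_assoc, ← RCLike.ofReal_mul,
    Real.mul_self_sqrt (Fact.out : 0 < κ).le]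

end H10

section Domain
variable (𝕜 : Type*) [RCLike 𝕜] (κ : ℝ)

/-- The Hilbert space `H²(I) ∩ H¹₀(I)`, with inner product `(u'', w'')_{L²} + (u, w)_{H¹₀}`. -/
def H2H10 : Type _ := (H2sub 𝕜).comap (H10.toH1 𝕜 κ)

instance : AddCommGroup (H2H10 𝕜 κ) :=
  inferInstanceAs (AddCommGroup ((H2sub 𝕜).comap (H10.toH1 𝕜 κ)))
instance : Module 𝕜 (H2H10 𝕜 κ) :=
  inferInstanceAs (Module 𝕜 ((H2sub 𝕜).comap (H10.toH1 𝕜 κ)))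
instance : Module ℝ (H2H10 𝕜 κ) :=
  inferInstanceAs (Module ℝ ((H2sub 𝕜).comap (H10.toH1 𝕜 κ)))
instance : IsScalarTower ℝ 𝕜 (H2H10 𝕜 κ) :=
  inferInstanceAs (IsScalarTower ℝ 𝕜 ((H2sub 𝕜).comap (H10.toH1 𝕜 κ)))

/-- The inclusion `H²(I) ∩ H¹₀(I) ⊆ H¹₀(I)`. -/
def H2H10.toH10 : H2H10 𝕜 κ →ₗ[𝕜] H10 𝕜 κ := ((H2sub 𝕜).comap (H10.toH1 𝕜 κ)).subtype

/-- The second derivative `u ↦ u''` on `H²(I) ∩ H¹₀(I)`. -/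
def H2H10.second : H2H10 𝕜 κ →ₗ[𝕜] L2 𝕜 :=
  weakDeriv₂ 𝕜 ∘ₗ (H10.toH1 𝕜 κ ∘ₗ H2H10.toH10 𝕜 κ).codRestrict (H2sub 𝕜) fun u => u.2

/-- The linear map `u ↦ (u'', u)`, which induces the norm of `H²(I) ∩ H¹₀(I)`. -/
def H2H10.jet : H2H10 𝕜 κ →ₗ[𝕜] WithLp 2 (L2 𝕜 × H10 𝕜 κ) :=
  (WithLp.linearEquiv 2 𝕜 (L2 𝕜 × H10 𝕜 κ)).symm.toLinearMap ∘ₗ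
    (H2H10.second 𝕜 κ).prod (H2H10.toH10 𝕜 κ)

theorem H2H10.jet_injective : Function.Injective (H2H10.jet 𝕜 κ) := fun _ _ h =>
  Subtype.ext (congrArg WithLp.snd h)

section Norm
variable [Fact (0 < κ)]

instance : NormedAddCommGroup (H2H10 𝕜 κ) :=
  NormedAddCommGroup.induced _ _ (H2H10.jet 𝕜 κ) (H2H10.jet_injective 𝕜 κ)

instance : InnerProductSpace 𝕜 (H2H10 𝕜 κ) := InnerProductSpace.induced (H2H10.jet 𝕜 κ)

instance : NormedSpace ℝ (H2H10 𝕜 κ) :=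
  NormedSpace.induced ℝ _ _ ((H2H10.jet 𝕜 κ).restrictScalars ℝ)

theorem H2H10.inner_def (u w : H2H10 𝕜 κ) :
    inner 𝕜 u w = inner 𝕜 (H2H10.second 𝕜 κ u) (H2H10.second 𝕜 κ w) +
      inner 𝕜 (H2H10.toH10 𝕜 κ u) (H2H10.toH10 𝕜 κ w) := rfl

end Norm

/-- The Hilbert space `ℋ = H¹₀(I) × L²(I)`. -/
abbrev Energy : Type _ := WithLp 2 (H10 𝕜 κ × L2 𝕜)

/-- The Hilbert space `D(U) = (H²(I) ∩ H¹₀(I)) × H¹₀(I)`, with inner product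
`(u₁'', u₂'')_{L²} + (u₁, u₂)_{H¹₀} + (v₁, v₂)_{H¹₀}`. -/
abbrev WaveDomain : Type _ := WithLp 2 (H2H10 𝕜 κ × H10 𝕜 κ)

/-- The inclusion `D(U) ⊆ ℋ`. -/
def WaveDomain.incl : WaveDomain 𝕜 κ →ₗ[𝕜] Energy 𝕜 κ :=
  (WithLp.linearEquiv 2 𝕜 (H10 𝕜 κ × L2 𝕜)).symm.toLinearMap ∘ₗ
    (H2H10.toH10 𝕜 κ).prodMap ((H1 𝕜).subtype ∘ₗ H10.toH1 𝕜 κ) ∘ₗ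
    (WithLp.linearEquiv 2 𝕜 (H2H10 𝕜 κ × H10 𝕜 κ)).toLinearMap

theorem WaveDomain.incl_apply (f : WaveDomain 𝕜 κ) :
    WaveDomain.incl 𝕜 κ f =
      WithLp.toLp 2 (H2H10.toH10 𝕜 κ f.fst, (H10.toH1 𝕜 κ f.snd : L2 𝕜)) := rfl

theorem WaveDomain.incl_injective : Function.Injective (WaveDomain.incl 𝕜 κ) := by
  intro f g h
  have h1 : H2H10.toH10 𝕜 κ f.fst = H2H10.toH10 𝕜 κ g.fst := congrArg WithLp.fst h
  have h2 : (H10.toH1 𝕜 κ f.snd : L2 𝕜) = H10.toH1 𝕜 κ g.snd := congrArg WithLp.snd h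
  have h3 : f.fst = g.fst := Subtype.ext h1
  have h4 : f.snd = g.snd := Subtype.ext (Subtype.ext h2)
  exact WithLp.ofLp_injective 2 (Prod.ext h3 h4)

/-- The action `(u, v) ↦ (v, κ u'' - ν v)` of the damped-wave operator on `D(U)`. -/
def waveAction (ν : ℝ) : WaveDomain 𝕜 κ →ₗ[𝕜] Energy 𝕜 κ :=
  (WithLp.linearEquiv 2 𝕜 (H10 𝕜 κ × L2 𝕜)).symm.toLinearMap ∘ₗ
    (WithLp.sndₗ 2 𝕜 (H2H10 𝕜 κ) (H10 𝕜 κ)).prod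
      ((κ : 𝕜) • (H2H10.second 𝕜 κ ∘ₗ WithLp.fstₗ 2 𝕜 (H2H10 𝕜 κ) (H10 𝕜 κ)) -
        (ν : 𝕜) • ((H1 𝕜).subtype ∘ₗ H10.toH1 𝕜 κ ∘ₗ WithLp.sndₗ 2 𝕜 (H2H10 𝕜 κ) (H10 𝕜 κ)))

theorem waveAction_apply (ν : ℝ) (f : WaveDomain 𝕜 κ) :
    waveAction 𝕜 κ ν f =
      WithLp.toLp 2 (f.snd,
        (κ : 𝕜) • H2H10.second 𝕜 κ f.fst - (ν : 𝕜) • (H10.toH1 𝕜 κ f.snd : L2 𝕜)) := rfl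

/-- The damped-wave operator `U = [[0, I], [κ d²/dx², -ν I]]` in `ℋ`, with domain `D(U)`. -/
def waveOp (ν : ℝ) : Energy 𝕜 κ →ₗ.[𝕜] Energy 𝕜 κ where
  domain := LinearMap.range (WaveDomain.incl 𝕜 κ)
  toFun := waveAction 𝕜 κ ν ∘ₗ
    (LinearEquiv.ofInjective (WaveDomain.incl 𝕜 κ) (WaveDomain.incl_injective 𝕜 κ)).symm.toLinearMap

/-- An element of `D(U)`, seen in the domain of the partially defined operator `U`. -/
def WaveDomain.toDomain (ν : ℝ) (f : WaveDomain 𝕜 κ) : (waveOp 𝕜 κ ν).domain :=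
  ⟨WaveDomain.incl 𝕜 κ f, LinearMap.mem_range_self _ f⟩

theorem waveOp_apply (ν : ℝ) (f : WaveDomain 𝕜 κ) :
    waveOp 𝕜 κ ν (WaveDomain.toDomain 𝕜 κ ν f) = waveAction 𝕜 κ ν f :=
  congrArg (waveAction 𝕜 κ ν)
    ((LinearEquiv.ofInjective (WaveDomain.incl 𝕜 κ)
      (WaveDomain.incl_injective 𝕜 κ)).symm_apply_apply f)

end Domain

section Semigroup
variable {𝕜 : Type*} [RCLike 𝕜] {E : Type*} [NormedAddCommGroup E] [NormedSpace 𝕜 E]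

/-- The resolvent set of an unbounded operator `A`: the `z` for which `z - A` is a bijection of the
domain of `A` onto the whole space with a bounded inverse `R`. -/
def opResolventSet (A : E →ₗ.[𝕜] E) : Set 𝕜 :=
  {z | ∃ R : E →L[𝕜] E,
    (∀ f : A.domain, R (z • (f : E) - A f) = f) ∧
    ∀ g : E, ∃ h : R g ∈ A.domain, z • R g - A ⟨R g, h⟩ = g}

/-- `(T(t))_{t ≥ 0}` is a strongly continuous semigroup of contractions. The values of `T` at
negative times play no role. -/
structure IsContractionSemigroup (T : ℝ → E →L[𝕜] E) : Prop where
  zero : T 0 = ContinuousLinearMap.id 𝕜 E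
  add : ∀ s t : ℝ, 0 ≤ s → 0 ≤ t → T (s + t) = T s ∘L T t
  continuousOn : ∀ f : E, ContinuousOn (fun t => T t f) (Ici 0)
  contraction : ∀ t : ℝ, 0 ≤ t → ‖T t‖ ≤ 1

/-- `A` is the generator of `T`: `f` lies in the domain of `A` with `A f = g` if and only if
`(T(t) f - f) / t → g` as `t → 0+`. -/
def IsGenerator [NormedSpace ℝ E] (A : E →ₗ.[𝕜] E) (T : ℝ → E →L[𝕜] E) : Prop :=
  ∀ f g : E, (∃ h : f ∈ A.domain, A ⟨f, h⟩ = g) ↔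
    Tendsto (fun t : ℝ => t⁻¹ • (T t f - f)) (𝓝[>] 0) (𝓝 g)

end Semigroup

/-- `θ_n = n² π² κ - ν²`. -/
def thetaSeq (κ ν : ℝ) (n : ℕ) : ℝ := n ^ 2 * Real.pi ^ 2 * κ - ν ^ 2

open Classical in
/-- `θ = -ν/2` if `θ_n ≥ 0` for all `n ≥ 1`, and otherwise `θ` is the maximum of the numbers
`-ν/2 + √(ν² - n² π² κ)/2` over the `n ≥ 1` with `θ_n < 0`. -/
def theta (κ ν : ℝ) : ℝ :=
  if ∀ n : ℕ, 1 ≤ n → 0 ≤ thetaSeq κ ν n then -ν / 2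
  else sSup {r : ℝ | ∃ n : ℕ, 1 ≤ n ∧ thetaSeq κ ν n < 0 ∧
    r = -ν / 2 + √(ν ^ 2 - n ^ 2 * Real.pi ^ 2 * κ) / 2}

/-- In the second case of the definition of `θ` the supremum is a maximum. -/
theorem theta_isGreatest {κ ν : ℝ} (hκ : 0 < κ)
    (h : ¬ ∀ n : ℕ, 1 ≤ n → 0 ≤ thetaSeq κ ν n) :
    IsGreatest {r : ℝ | ∃ n : ℕ, 1 ≤ n ∧ thetaSeq κ ν n < 0 ∧
      r = -ν / 2 + √(ν ^ 2 - n ^ 2 * Real.pi ^ 2 * κ) / 2} (theta κ ν) := by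
  have hm : ∀ n : ℕ, 1 ≤ n → 1 ^ 2 * Real.pi ^ 2 * κ ≤ (n : ℝ) ^ 2 * Real.pi ^ 2 * κ := by
    intro n hn
    have : (1 : ℝ) ≤ n := by exact_mod_cast hn
    gcongr
  have hg : IsGreatest {r : ℝ | ∃ n : ℕ, 1 ≤ n ∧ thetaSeq κ ν n < 0 ∧
      r = -ν / 2 + √(ν ^ 2 - n ^ 2 * Real.pi ^ 2 * κ) / 2}
      (-ν / 2 + √(ν ^ 2 - ((1 : ℕ) : ℝ) ^ 2 * Real.pi ^ 2 * κ) / 2) := by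
    refine ⟨⟨1, le_rfl, ?_, rfl⟩, ?_⟩
    · push Not at h
      obtain ⟨n, hn, h1⟩ := h
      have := hm n hn
      unfold thetaSeq at h1 ⊢
      push_cast
      linarith
    · rintro r ⟨n, hn, -, rfl⟩
      have := hm n hn
      have : √(ν ^ 2 - (n : ℝ) ^ 2 * Real.pi ^ 2 * κ) ≤
          √(ν ^ 2 - ((1 : ℕ) : ℝ) ^ 2 * Real.pi ^ 2 * κ) := by
        apply Real.sqrt_le_sqrt
        push_cast
        linarith
      gcongr
  rw [theta, if_neg h, hg.csSup_eq]
  exact hg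

end DampedWave
end

open MeasureTheory Set Filter Topology DampedWave

/-!
The damped-wave operator is diagonalized by the Dirichlet eigenfunctions `sin (n π (x + 1) / 2)`,
`n ≥ 1`, of the interval `(-1, 1)`. Normalized in `H¹₀(I)` and in `L²(I)` respectively, they split
the energy space isometrically into a Hilbert sum of copies of `𝕜²` (`modeDecomp`), and
`exists_waveAction_iff` says that `f ∈ D(U)` and `U f = g` hold exactly if in each mode the
coordinates of `g` arise from those of `f` through the matrix `[[0, s], [-s, -ν]]`, where
`s = √κ n π / 2`. So the domain needs no separate description, and every assertion about `U` becomes one about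
these matrices, uniformly in `s`.

The analytic input is as follows. The sines are complete in `L²(I)`
(`eq_zero_of_inner_sine_eq_zero`), since they span the products of `sin θ` with the polynomials in
`cos θ`, where `θ = π (x + 1) / 2`. They lie in `H¹₀(I)` (`toL2_mem_closure_testPairs`), where pairing with them is
the same as pairing in `L²(I)` up to the factor `s²` (`inner_sineH10`), so they are complete there
too. Finally, a weak derivative may be tested with the sines only (`hasWeakDeriv_of_inner_sine`),
which identifies the domain.

Given the diagonalization, closedness holds coordinate by coordinate. The semigroup is block
diagonal with blocks `exp (t M)`, and `U` is its generator because `T(t) f - f` is the integral of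
`T(s) U f` over `[0, t]`, again by a comparison of coordinates (`isGenerator_blockSemigroup`). The
blocks are contractions because the energy of a mode is nonincreasing, and they decay exponentially
at a rate independent of the mode, by a Lyapunov functional (`exists_norm_expFlow_waveBlock_le`).
The resolvents of the blocks are `O(1 / s)`, and exist at `z` if and only if `z² + ν z + s² ≠ 0`,
which holds for `Re z > θ` (`charPoly_ne_zero`).

As `0` lies in the resolvent set, and the norm of `D(U)` is bounded by `‖U f‖`
(`exists_norm_le_waveAction`), `U` is an isomorphism from `D(U)` onto the energy space. The
restriction of `T(t)` to `D(U)` is therefore `U⁻¹ T(t) U`, which inherits strong continuity and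
decay, and `U⁻¹` of the mild solution with data `U F₀`, `U F₁` is the classical solution
(`exists_classical_solution`).
-/

open MeasureTheory Set Filter Topology DampedWave

namespace DampedWave
open scoped ContDiff

/-! ### The flow of a bounded operator -/

section BlockFlow
variable {𝕜 : Type*} [RCLike 𝕜] {G : Type*} [NormedAddCommGroup G] [NormedSpace 𝕜 G]

/-- The flow `t ↦ exp (t M)` of a bounded operator `M`. -/
noncomputable def expFlow (M : G →L[𝕜] G) (t : ℝ) : G →L[𝕜] G :=
  NormedSpace.exp ((t : 𝕜) • M)

theorem expFlow_zero (M : G →L[𝕜] G) : expFlow M 0 = 1 := by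
  simp [expFlow]

theorem commute_expFlow (M N : G →L[𝕜] G) (h : Commute N M) (t : ℝ) :
    Commute N (expFlow M t) := by
  let : NormedAlgebra ℚ (G →L[𝕜] G) := NormedAlgebra.restrictScalars ℚ 𝕜 _
  exact (h.smul_right _).exp_right

theorem expFlow_apply_comm (M : G →L[𝕜] G) (t : ℝ) (x : G) :
    M (expFlow M t x) = expFlow M t (M x) :=
  congrArg (fun L : G →L[𝕜] G => L x) (commute_expFlow M M (Commute.refl M) t).eq

variable [CompleteSpace G]

theorem expFlow_add (M : G →L[𝕜] G) (s t : ℝ) :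
    expFlow M (s + t) = expFlow M s * expFlow M t := by
  let : NormedAlgebra ℚ (G →L[𝕜] G) := NormedAlgebra.restrictScalars ℚ 𝕜 _
  rw [expFlow, expFlow, expFlow, ← NormedSpace.exp_add_of_commute, ← add_smul, RCLike.ofReal_add]
  exact ((Commute.refl M).smul_left _).smul_right _

variable [NormedSpace ℝ G] [IsScalarTower ℝ 𝕜 G]

theorem hasDerivAt_expFlow (M : G →L[𝕜] G) (t : ℝ) :
    HasDerivAt (fun t => (expFlow M t).restrictScalars ℝ)
      ((M * expFlow M t).restrictScalars ℝ) t := by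
  have h1 : HasDerivAt (fun t => expFlow M t) (M * expFlow M t) t := by
    have h := (hasDerivAt_exp_smul_const' (𝕂 := 𝕜) M ((t : ℝ) : 𝕜)).scomp (𝕜 := ℝ) t
      (RCLike.ofRealCLM (K := 𝕜)).hasDerivAt
    rw [RCLike.ofRealCLM_apply, RCLike.ofReal_one, one_smul] at h
    exact h
  exact ((ContinuousLinearMap.restrictScalarsL 𝕜 G G ℝ ℝ).hasFDerivAt.comp_hasDerivAt t h1)

theorem hasDerivAt_expFlow_apply (M : G →L[𝕜] G) (x : G) (t : ℝ) :
    HasDerivAt (fun t => expFlow M t x) (M (expFlow M t x)) t := by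
  simpa using (hasDerivAt_expFlow M t).clm_apply (hasDerivAt_const t x)

theorem continuous_expFlow_apply (M : G →L[𝕜] G) (x : G) :
    Continuous fun t => expFlow M t x :=
  continuous_iff_continuousAt.2 fun t => (hasDerivAt_expFlow_apply M x t).continuousAt

theorem continuous_expFlow (M : G →L[𝕜] G) :
    Continuous fun t => (expFlow M t).restrictScalars ℝ :=
  continuous_iff_continuousAt.2 fun t => (hasDerivAt_expFlow M t).continuousAt

/-- Duhamel's formula solves `y' = M y + φ`. -/
theorem hasDerivAt_duhamel (M : G →L[𝕜] G) (x : G) {φ : ℝ → G} (hφ : Continuous φ) (t : ℝ) :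
    HasDerivAt (fun t => expFlow M t x + ∫ s in (0 : ℝ)..t, expFlow M (t - s) (φ s))
      (M (expFlow M t x + ∫ s in (0 : ℝ)..t, expFlow M (t - s) (φ s)) + φ t) t := by
  have hc : Continuous fun s => expFlow M (-s) (φ s) := by
    have := ((continuous_expFlow M).comp continuous_neg).clm_apply hφ
    simpa using! this
  -- Variation of constants: factor `exp (t M)` out of the integral.
  have key : ∀ t, expFlow M t x + ∫ s in (0 : ℝ)..t, expFlow M (t - s) (φ s) =
      expFlow M t (x + ∫ s in (0 : ℝ)..t, expFlow M (-s) (φ s)) := by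
    intro t
    rw [map_add, ← ContinuousLinearMap.intervalIntegral_comp_comm _ (hc.intervalIntegrable _ _)]
    simp only [sub_eq_add_neg, expFlow_add, mul_apply_eq_comp]
  simp only [key]
  have hI : HasDerivAt (fun t => x + ∫ s in (0 : ℝ)..t, expFlow M (-s) (φ s))
      (expFlow M (-t) (φ t)) t :=
    (intervalIntegral.integral_hasDerivAt_right (hc.intervalIntegrable _ _)
      (hc.stronglyMeasurableAtFilter _ _) hc.continuousAt).const_add x
  have h := (hasDerivAt_expFlow M t).clm_apply hI
  have hinv : expFlow M t (expFlow M (-t) (φ t)) = φ t := by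
    rw [← mul_apply_eq_comp, ← expFlow_add, add_neg_cancel, expFlow_zero,
      one_apply_eq_self]
  simpa [hinv] using! h

end BlockFlow

/-! ### Block diagonal operators on a Hilbert sum -/

section BlockOp
variable {𝕜 : Type*} [RCLike 𝕜] {ι : Type*} {G : ι → Type*} [∀ i, NormedAddCommGroup (G i)]
  [∀ i, InnerProductSpace 𝕜 (G i)] {E : Type*} [NormedAddCommGroup E] [InnerProductSpace 𝕜 E]

theorem hasSum_sq_norm_coord (W : E ≃ₗᵢ[𝕜] lp G 2) (f : E) :
    HasSum (fun i => ‖W f i‖ ^ 2) (‖f‖ ^ 2) := by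
  have h := lp.hasSum_norm (p := 2) (by norm_num) (W f)
  rw [W.norm_map] at h
  simpa using h

theorem coord_ext (W : E ≃ₗᵢ[𝕜] lp G 2) {f g : E} (h : ∀ i, W f i = W g i) : f = g :=
  W.injective (lp.ext (funext h))

/-- The `i`-th coordinate of a vector, with respect to an identification of the space with a Hilbert
sum, as a bounded operator. -/
noncomputable def coordCLM (W : E ≃ₗᵢ[𝕜] lp G 2) (i : ι) : E →L[𝕜] G i :=
  LinearMap.mkContinuous
    { toFun := fun f => W f i
      map_add' := fun f g => by simp
      map_smul' := fun c f => by simp } 1 fun f => by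
    have := lp.norm_apply_le_norm (p := 2) (by norm_num) (W f) i
    simpa using this

theorem coordCLM_apply (W : E ≃ₗᵢ[𝕜] lp G 2) (i : ι) (f : E) : coordCLM W i f = W f i := rfl

theorem memLp_block {N : ∀ i, G i →L[𝕜] G i} {C : ℝ} (hN : ∀ i, ‖N i‖ ≤ C) (f : lp G 2) :
    Memℓp (fun i => N i (f i)) 2 := by
  refine memℓp_gen ?_
  have hs := ((lp.memℓp f).summable (by norm_num)).mul_left (C ^ 2)
  refine hs.of_nonneg_of_le (fun i => by positivity) fun i => ?_
  have h1 : ‖N i (f i)‖ ≤ C * ‖f i‖ := (N i).le_of_opNorm_le (hN i) _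
  have h2 : ‖N i (f i)‖ ^ 2 ≤ (C * ‖f i‖) ^ 2 := by gcongr
  simpa [mul_pow] using h2

/-- The bounded operator that acts on the `i`-th summand of a Hilbert sum by `N i`, for a uniformly
bounded family `N`. -/
noncomputable def blockOp (W : E ≃ₗᵢ[𝕜] lp G 2) (N : ∀ i, G i →L[𝕜] G i) (C : ℝ) (hC : 0 ≤ C)
    (hN : ∀ i, ‖N i‖ ≤ C) : E →L[𝕜] E :=
  LinearMap.mkContinuous
    { toFun := fun f => W.symm ⟨fun i => N i (W f i), memLp_block hN (W f)⟩
      map_add' := fun f g => coord_ext W fun i => by simp; rfl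
      map_smul' := fun c f => coord_ext W fun i => by simp } C fun f => by
    have h1 := hasSum_sq_norm_coord W f
    have h2 := hasSum_sq_norm_coord W (W.symm ⟨fun i => N i (W f i), memLp_block hN (W f)⟩)
    refine abs_le_of_sq_le_sq' ?_ (by positivity) |>.2
    rw [mul_pow]
    refine hasSum_le (fun i => ?_) h2 (h1.mul_left (C ^ 2))
    have h3 : ‖N i (W f i)‖ ≤ C * ‖W f i‖ := (N i).le_of_opNorm_le (hN i) _
    rw [← mul_pow]
    simpa using pow_le_pow_left₀ (norm_nonneg _) h3 2

variable (W : E ≃ₗᵢ[𝕜] lp G 2) (N : ∀ i, G i →L[𝕜] G i) (C : ℝ) (hC : 0 ≤ C)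
    (hN : ∀ i, ‖N i‖ ≤ C)

theorem coord_blockOp (f : E) (i : ι) : W (blockOp W N C hC hN f) i = N i (W f i) := by
  simp [blockOp]

theorem norm_blockOp_le : ‖blockOp W N C hC hN‖ ≤ C := LinearMap.mkContinuous_norm_le _ hC _

/-- The bound of the family `N` in the definition of a block diagonal operator can be improved. -/
theorem norm_blockOp_le' {C' : ℝ} (hC' : 0 ≤ C') (hN' : ∀ i, ‖N i‖ ≤ C') :
    ‖blockOp W N C hC hN‖ ≤ C' := norm_blockOp_le W N C' hC' hN'

end BlockOp

/-! ### Block diagonal semigroups -/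

section BlockSemigroup
variable {𝕜 : Type*} [RCLike 𝕜] {ι : Type*} {G : ι → Type*} [∀ i, NormedAddCommGroup (G i)]
  [∀ i, InnerProductSpace 𝕜 (G i)] {E : Type*} [NormedAddCommGroup E] [InnerProductSpace 𝕜 E]

/-- The block diagonal semigroup with blocks `exp (t (M i))`, frozen at the identity for negative
times, so that its orbits are continuous on the whole line. -/
noncomputable def blockSemigroup (W : E ≃ₗᵢ[𝕜] lp G 2) (M : ∀ i, G i →L[𝕜] G i)
    (hM : ∀ i t, 0 ≤ t → ‖expFlow (M i) t‖ ≤ 1) (t : ℝ) : E →L[𝕜] E :=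
  blockOp W (fun i => expFlow (M i) (max t 0)) 1 zero_le_one fun i => hM i _ (le_max_right _ _)

variable (W : E ≃ₗᵢ[𝕜] lp G 2) {M : ∀ i, G i →L[𝕜] G i}
  (hM : ∀ i t, 0 ≤ t → ‖expFlow (M i) t‖ ≤ 1)

theorem coord_blockSemigroup (t : ℝ) (f : E) (i : ι) :
    W (blockSemigroup W M hM t f) i = expFlow (M i) (max t 0) (W f i) :=
  coord_blockOp _ _ _ _ _ _ _

theorem coord_blockSemigroup_of_nonneg {t : ℝ} (ht : 0 ≤ t) (f : E) (i : ι) :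
    W (blockSemigroup W M hM t f) i = expFlow (M i) t (W f i) := by
  rw [coord_blockSemigroup, max_eq_left ht]

theorem norm_blockSemigroup_le_one (t : ℝ) : ‖blockSemigroup W M hM t‖ ≤ 1 :=
  norm_blockOp_le _ _ _ _ _

theorem norm_blockSemigroup_le {t C : ℝ} (ht : 0 ≤ t) (hC : 0 ≤ C)
    (h : ∀ i, ‖expFlow (M i) t‖ ≤ C) : ‖blockSemigroup W M hM t‖ ≤ C :=
  norm_blockOp_le' _ _ _ _ _ hC (by simpa only [max_eq_left ht] using h)

variable [∀ i, CompleteSpace (G i)] [∀ i, NormedSpace ℝ (G i)] [∀ i, IsScalarTower ℝ 𝕜 (G i)]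

/-- Strong continuity: each coordinate is continuous, and the coordinates of the difference of two
values are dominated by those of `2 f`. -/
theorem continuous_blockSemigroup_apply (f : E) :
    Continuous fun t => blockSemigroup W M hM t f := by
  refine continuous_iff_continuousAt.2 fun t => ?_
  rw [ContinuousAt, tendsto_iff_norm_sub_tendsto_zero]
  have hsq : Tendsto (fun s => ‖blockSemigroup W M hM s f - blockSemigroup W M hM t f‖ ^ 2)
      (𝓝 t) (𝓝 0) := by
    have h0 : (0 : ℝ) = ∑' _ : ι, (0 : ℝ) := by simp
    rw [h0]
    simp only [← (hasSum_sq_norm_coord W _).tsum_eq]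
    refine tendsto_tsum_of_dominated_convergence (bound := fun i => 4 * ‖W f i‖ ^ 2)
      ((hasSum_sq_norm_coord W f).summable.mul_left 4) (fun i => ?_)
      (Eventually.of_forall fun s i => ?_)
    · have hc : Continuous fun s : ℝ => expFlow (M i) (max s 0) (W f i) :=
        (continuous_expFlow_apply (M i) (W f i)).comp (continuous_id.max continuous_const)
      have h1 := ((hc.sub continuous_const).norm.pow 2).tendsto' t
        (‖expFlow (M i) (max t 0) (W f i) - expFlow (M i) (max t 0) (W f i)‖ ^ 2) rfl
      simpa [coord_blockSemigroup] using! h1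
    · have hle : ∀ r : ℝ, ‖expFlow (M i) (max r 0) (W f i)‖ ≤ ‖W f i‖ := fun r => by
        simpa using (expFlow (M i) (max r 0)).le_of_opNorm_le (hM i _ (le_max_right _ _)) (W f i)
      have h2 : ‖W (blockSemigroup W M hM s f - blockSemigroup W M hM t f) i‖ ≤ 2 * ‖W f i‖ := by
        rw [map_sub, lp.coeFn_sub, Pi.sub_apply, coord_blockSemigroup, coord_blockSemigroup]
        linarith [norm_sub_le (expFlow (M i) (max s 0) (W f i))
          (expFlow (M i) (max t 0) (W f i)), hle s, hle t]
      rw [Real.norm_of_nonneg (by positivity)]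
      calc _ ≤ (2 * ‖W f i‖) ^ 2 := by gcongr
        _ = 4 * ‖W f i‖ ^ 2 := by ring
  have := hsq.sqrt
  simpa [Real.sqrt_sq] using this

theorem continuous_blockSemigroup_comp {X : Type*} [TopologicalSpace X] {τ : X → ℝ} {g : X → E}
    (hτ : Continuous τ) (hg : Continuous g) :
    Continuous fun x => blockSemigroup W M hM (τ x) (g x) := by
  refine continuous_iff_continuousAt.2 fun x => ?_
  rw [ContinuousAt, tendsto_iff_norm_sub_tendsto_zero]
  have h1 : Tendsto (fun y => ‖g y - g x‖) (𝓝 x) (𝓝 0) :=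
    tendsto_iff_norm_sub_tendsto_zero.1 hg.continuousAt
  have h2 : Tendsto (fun y => ‖blockSemigroup W M hM (τ y) (g x) -
      blockSemigroup W M hM (τ x) (g x)‖) (𝓝 x) (𝓝 0) :=
    tendsto_iff_norm_sub_tendsto_zero.1
      ((continuous_blockSemigroup_apply W hM (g x)).comp hτ).continuousAt
  refine squeeze_zero (fun _ => norm_nonneg _) (fun y => ?_) (by simpa using h1.add h2)
  have h3 : ‖blockSemigroup W M hM (τ y) (g y - g x)‖ ≤ ‖g y - g x‖ := by
    simpa using (blockSemigroup W M hM (τ y)).le_of_opNorm_le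
      (norm_blockSemigroup_le_one W hM _) (g y - g x)
  refine le_trans (le_of_eq_of_le ?_ (norm_add_le (blockSemigroup W M hM (τ y) (g y - g x)) _))
    (add_le_add_left h3 _)
  rw [map_sub]
  abel_nf

theorem isContractionSemigroup_blockSemigroup :
    IsContractionSemigroup (blockSemigroup W M hM) where
  zero := by
    ext f
    refine coord_ext W fun i => ?_
    rw [coord_blockSemigroup_of_nonneg W hM le_rfl, expFlow_zero]
    rfl
  add s t hs ht := by
    ext f
    refine coord_ext W fun i => ?_
    rw [ContinuousLinearMap.comp_apply, coord_blockSemigroup_of_nonneg W hM (add_nonneg hs ht),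
      coord_blockSemigroup_of_nonneg W hM hs, coord_blockSemigroup_of_nonneg W hM ht, expFlow_add]
    rfl
  continuousOn f := (continuous_blockSemigroup_apply W hM f).continuousOn
  contraction t _ := norm_blockSemigroup_le_one W hM t

variable [CompleteSpace E] [NormedSpace ℝ E]

theorem isGenerator_blockSemigroup [IsScalarTower ℝ 𝕜 E] {A : E →ₗ.[𝕜] E}
    (hA : ∀ f g, (∃ h : f ∈ A.domain, A ⟨f, h⟩ = g) ↔ ∀ i, M i (W f i) = W g i) :
    IsGenerator A (blockSemigroup W M hM) := by
  intro f g
  rw [hA]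
  constructor
  · intro h
    -- `T(t) f - f` is the integral over `[0, t]` of the continuous function `s ↦ T(s) g`.
    have hcg := continuous_blockSemigroup_apply W hM g
    have hint : ∀ t : ℝ, 0 ≤ t →
        f + ∫ s in (0 : ℝ)..t, blockSemigroup W M hM s g = blockSemigroup W M hM t f := by
      intro t ht
      refine coord_ext W fun i => ?_
      rw [map_add, lp.coeFn_add, Pi.add_apply, ← coordCLM_apply W i (∫ s in (0 : ℝ)..t, _),
        ← ContinuousLinearMap.intervalIntegral_comp_comm _ (hcg.intervalIntegrable _ _),
        coord_blockSemigroup_of_nonneg W hM ht]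
      have h1 : ∫ s in (0 : ℝ)..t, coordCLM W i (blockSemigroup W M hM s g) =
          ∫ s in (0 : ℝ)..t, M i (expFlow (M i) s (W f i)) := by
        refine intervalIntegral.integral_congr fun s hs => ?_
        rw [uIcc_of_le ht] at hs
        simp only [coordCLM_apply]
        rw [coord_blockSemigroup_of_nonneg W hM hs.1, ← h i, expFlow_apply_comm]
      rw [h1, intervalIntegral.integral_eq_sub_of_hasDerivAt
        (fun s _ => hasDerivAt_expFlow_apply (M i) (W f i) s)
        (((M i).continuous.comp (continuous_expFlow_apply (M i) (W f i))).intervalIntegrable _ _),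
        expFlow_zero, one_apply_eq_self, add_sub_cancel]
    have hd : HasDerivAt (fun t => f + ∫ s in (0 : ℝ)..t, blockSemigroup W M hM s g)
        (blockSemigroup W M hM 0 g) 0 :=
      (intervalIntegral.integral_hasDerivAt_right (hcg.intervalIntegrable _ _)
        (hcg.stronglyMeasurableAtFilter _ _) hcg.continuousAt).const_add f
    have h0 : blockSemigroup W M hM 0 g = g := by
      rw [(isContractionSemigroup_blockSemigroup W hM).zero]; rfl
    rw [h0] at hd
    have := (hasDerivAt_iff_tendsto_slope_zero.1 hd).mono_left
      (nhdsWithin_mono (0 : ℝ) (t := {0}ᶜ) (s := Ioi 0) fun x hx => ne_of_gt hx)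
    refine this.congr' ?_
    filter_upwards [self_mem_nhdsWithin] with t ht
    rw [zero_add, hint t (le_of_lt ht)]
    simp
  · intro h i
    have h1 : Tendsto (fun t : ℝ => coordCLM W i (t⁻¹ • (blockSemigroup W M hM t f - f))) (𝓝[>] 0)
        (𝓝 (coordCLM W i g)) := ((coordCLM W i).continuous.tendsto g).comp h
    have h2 := (hasDerivAt_iff_tendsto_slope_zero.1
      (hasDerivAt_expFlow_apply (M i) (W f i) 0)).mono_left
      (nhdsWithin_mono (0 : ℝ) (t := {0}ᶜ) (s := Ioi 0) fun x hx => ne_of_gt hx)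
    rw [expFlow_zero, one_apply_eq_self] at h2
    refine tendsto_nhds_unique h2 (h1.congr' ?_)
    filter_upwards [self_mem_nhdsWithin] with t ht
    rw [zero_add, ContinuousLinearMap.map_smul_of_tower, map_sub, coordCLM_apply, coordCLM_apply,
      coord_blockSemigroup_of_nonneg W hM (le_of_lt ht)]

omit [CompleteSpace E] [NormedSpace ℝ E] [∀ i, CompleteSpace (G i)]
  [∀ i, NormedSpace ℝ (G i)] [∀ i, IsScalarTower ℝ 𝕜 (G i)] in
theorem isClosed_of_coord {A : E →ₗ.[𝕜] E}
    (hA : ∀ f g, (∃ h : f ∈ A.domain, A ⟨f, h⟩ = g) ↔ ∀ i, M i (W f i) = W g i) :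
    A.IsClosed := by
  have : (A.graph : Set (E × E)) =
      ⋂ i, {p | M i (coordCLM W i p.1) = coordCLM W i p.2} := by
    ext p
    rw [mem_iInter, SetLike.mem_coe, LinearPMap.mem_graph_iff]
    refine Iff.trans ⟨?_, ?_⟩ (hA p.1 p.2)
    · rintro ⟨y, hy, hy'⟩
      obtain ⟨y, hyd⟩ := y
      subst hy
      exact ⟨hyd, hy'⟩
    · rintro ⟨h, h'⟩
      exact ⟨⟨_, h⟩, rfl, h'⟩
  rw [LinearPMap.IsClosed, this]
  refine isClosed_iInter fun i => isClosed_eq ?_ ?_ <;> fun_prop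

omit [CompleteSpace E] [NormedSpace ℝ E] [∀ i, CompleteSpace (G i)]
  [∀ i, NormedSpace ℝ (G i)] [∀ i, IsScalarTower ℝ 𝕜 (G i)] in
/-- If the resolvents at `z` of the blocks exist and are uniformly bounded, then `z` belongs to the
resolvent set of the block diagonal operator. -/
theorem mem_opResolventSet_of_coord {A : E →ₗ.[𝕜] E}
    (hA : ∀ f g, (∃ h : f ∈ A.domain, A ⟨f, h⟩ = g) ↔ ∀ i, M i (W f i) = W g i)
    {z : 𝕜} {N : ∀ i, G i →L[𝕜] G i} {C : ℝ} (hC : 0 ≤ C) (hN : ∀ i, ‖N i‖ ≤ C)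
    (hl : ∀ i x, N i (z • x - M i x) = x) (hr : ∀ i x, z • N i x - M i (N i x) = x) :
    z ∈ opResolventSet A := by
  refine ⟨blockOp W N C hC hN, fun f => coord_ext W fun i => ?_, fun g => ?_⟩
  · have := (hA f (A f)).1 ⟨f.2, rfl⟩ i
    rw [coord_blockOp, map_sub, map_smul, lp.coeFn_sub, lp.coeFn_smul, Pi.sub_apply, Pi.smul_apply,
      ← this, hl]
  · obtain ⟨h, h'⟩ := (hA (blockOp W N C hC hN g) (z • blockOp W N C hC hN g - g)).2 fun i => by
      rw [map_sub, map_smul, lp.coeFn_sub, lp.coeFn_smul, Pi.sub_apply, Pi.smul_apply,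
        coord_blockOp, eq_sub_iff_add_eq, add_comm, ← eq_sub_iff_add_eq, hr]
    exact ⟨h, by rw [h', sub_sub_cancel]⟩

section Mild
variable {D : Type*} [NormedAddCommGroup D] [NormedSpace 𝕜 D] {J B : D →L[𝕜] E} {S : E →L[𝕜] D}

omit [CompleteSpace E] [NormedSpace ℝ E] [∀ i, CompleteSpace (G i)]
  [∀ i, NormedSpace ℝ (G i)] [∀ i, IsScalarTower ℝ 𝕜 (G i)] in
/-- The semigroup commutes with its generator `B`, hence leaves the domain `D` invariant, where it
acts as `S T(t) B` with `S` the inverse of `B`. -/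
theorem blockSemigroup_domain (hD : ∀ f g, (∃ d, J d = f ∧ B d = g) ↔ ∀ i, M i (W f i) = W g i)
    (hSB : ∀ d, S (B d) = d) {t : ℝ} (ht : 0 ≤ t) (d : D) :
    J (S (blockSemigroup W M hM t (B d))) = blockSemigroup W M hM t (J d) := by
  obtain ⟨d', h1, h2⟩ := (hD (blockSemigroup W M hM t (J d)) (blockSemigroup W M hM t (B d))).2
    fun i => by
      rw [coord_blockSemigroup_of_nonneg W hM ht, coord_blockSemigroup_of_nonneg W hM ht,
        expFlow_apply_comm, (hD (J d) (B d)).1 ⟨d, rfl, rfl⟩ i]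
  rw [← h2, hSB, h1]

/-- Classical solvability of `V' = A V + F₁`, `V(0) = F₀` for data in the domain of the generator
`A` of a block diagonal semigroup. The domain is presented as a normed space `D` with inclusion `J`,
on which `A` acts as an isomorphism `B` with inverse `S`. -/
theorem exists_classical_solution
    (hD : ∀ f g, (∃ d, J d = f ∧ B d = g) ↔ ∀ i, M i (W f i) = W g i)
    (hSB : ∀ d, S (B d) = d) (hBS : ∀ g, B (S g) = g) {T₀ : ℝ} (hT₀ : 0 < T₀) (F₀ : D)
    {F₁ : ℝ → D} (hF₁ : ContinuousOn F₁ (Icc 0 T₀)) :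
    (∀ t ∈ Icc 0 T₀, IntervalIntegrable
        (fun s => blockSemigroup W M hM (t - s) (J (F₁ s))) volume 0 t) ∧
      ∃ V : ℝ → D,
        (∀ t ∈ Icc 0 T₀, J (V t) = blockSemigroup W M hM t (J F₀) +
          ∫ s in (0 : ℝ)..t, blockSemigroup W M hM (t - s) (J (F₁ s))) ∧
        ContinuousOn V (Icc 0 T₀) ∧
        (∀ t ∈ Ioc 0 T₀, HasDerivWithinAt (fun r => J (V r)) (B (V t) + J (F₁ t)) (Icc 0 T₀) t) ∧
        V 0 = F₀ := by
  -- Extend the forcing term continuously to the whole line.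
  set F : ℝ → D := IccExtend hT₀.le ((Icc 0 T₀).domRestrict F₁) with hF
  have hFc : Continuous F := (continuousOn_iff_continuous_domRestrict.1 hF₁).Icc_extend'
  have hFF : ∀ s ∈ Icc 0 T₀, F s = F₁ s := fun s hs => IccExtend_of_mem hT₀.le _ hs
  set T := blockSemigroup W M hM with hT
  have hsub : ∀ t ∈ Icc 0 T₀, ∀ s ∈ uIcc 0 t, F s = F₁ s := fun t ht s hs => by
    rw [uIcc_of_le ht.1] at hs
    exact hFF s ⟨hs.1, hs.2.trans ht.2⟩
  have hcJ : ∀ t, Continuous fun s => T (t - s) (J (F s)) := fun t =>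
    continuous_blockSemigroup_comp W hM (continuous_const.sub continuous_id) (J.continuous.comp hFc)
  have hcB : ∀ t, Continuous fun s => T (t - s) (B (F s)) := fun t =>
    continuous_blockSemigroup_comp W hM (continuous_const.sub continuous_id) (B.continuous.comp hFc)
  refine ⟨fun t ht => ?_, ?_⟩
  · refine ContinuousOn.intervalIntegrable ((hcJ t).continuousOn.congr fun s hs => ?_)
    simp only [hsub t ht s hs]
  -- `Vt` is `A V`, from which `V` is recovered by `S`.
  set Vt : ℝ → E := fun t => T t (B F₀) + ∫ s in (0 : ℝ)..t, T (t - s) (B (F s)) with hVt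
  have hVtc : Continuous Vt := by
    refine (continuous_blockSemigroup_apply W hM _).add
      (intervalIntegral.continuous_parametric_intervalIntegral_of_continuous ?_ continuous_id)
    exact continuous_blockSemigroup_comp W hM (continuous_fst.sub continuous_snd)
      ((B.continuous.comp hFc).comp continuous_snd)
  have hJV : ∀ t, 0 ≤ t → J (S (Vt t)) = T t (J F₀) + ∫ s in (0 : ℝ)..t, T (t - s) (J (F s)) := by
    intro t ht
    rw [hVt]
    simp only [map_add]
    rw [hT, blockSemigroup_domain W hM hD hSB ht, ← hT, ← ContinuousLinearMap.comp_apply J S,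
      ← ContinuousLinearMap.intervalIntegral_comp_comm _ ((hcB t).intervalIntegrable _ _)]
    congr 1
    refine intervalIntegral.integral_congr fun s hs => ?_
    rw [uIcc_of_le ht] at hs
    exact blockSemigroup_domain W hM hD hSB (sub_nonneg.2 hs.2) _
  have hcoord : ∀ t, 0 ≤ t → ∀ i, W (J (S (Vt t))) i = expFlow (M i) t (W (J F₀) i) +
      ∫ s in (0 : ℝ)..t, expFlow (M i) (t - s) (W (J (F s)) i) := by
    intro t ht i
    rw [hJV t ht, map_add, lp.coeFn_add, Pi.add_apply, hT,
      coord_blockSemigroup_of_nonneg W hM ht, ← hT, ← coordCLM_apply W i (∫ s in (0 : ℝ)..t, _),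
      ← ContinuousLinearMap.intervalIntegral_comp_comm _ ((hcJ t).intervalIntegrable _ _)]
    congr 1
    refine intervalIntegral.integral_congr fun s hs => ?_
    rw [uIcc_of_le ht] at hs
    exact coord_blockSemigroup_of_nonneg W hM (sub_nonneg.2 hs.2) _ _
  have hcI : Continuous fun s => Vt s + J (F s) := hVtc.add (J.continuous.comp hFc)
  have hint : ∀ t, 0 ≤ t → J (S (Vt t)) = J F₀ + ∫ s in (0 : ℝ)..t, (Vt s + J (F s)) := by
    intro t ht
    refine coord_ext W fun i => ?_
    have hφ : Continuous fun s => W (J (F s)) i :=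
      (coordCLM W i).continuous.comp (J.continuous.comp hFc)
    have hder := hasDerivAt_duhamel (M i) (W (J F₀) i) hφ
    have hyc : Continuous fun t => expFlow (M i) t (W (J F₀) i) +
        ∫ s in (0 : ℝ)..t, expFlow (M i) (t - s) (W (J (F s)) i) :=
      continuous_iff_continuousAt.2 fun t => (hder t).continuousAt
    have hftc := intervalIntegral.integral_eq_sub_of_hasDerivAt (a := 0) (b := t)
      (fun s _ => hder s) ((((M i).continuous.comp hyc).add hφ).intervalIntegrable _ _)
    rw [hcoord t ht, map_add, lp.coeFn_add, Pi.add_apply,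
      ← coordCLM_apply W i (∫ s in (0 : ℝ)..t, _),
      ← ContinuousLinearMap.intervalIntegral_comp_comm _ (hcI.intervalIntegrable _ _)]
    have hcong : ∫ s in (0 : ℝ)..t, coordCLM W i (Vt s + J (F s)) =
        ∫ s in (0 : ℝ)..t, (M i (expFlow (M i) s (W (J F₀) i) +
          ∫ r in (0 : ℝ)..s, expFlow (M i) (s - r) (W (J (F r)) i)) + W (J (F s)) i) := by
      refine intervalIntegral.integral_congr fun s hs => ?_
      rw [uIcc_of_le ht] at hs
      simp only [map_add, coordCLM_apply]
      rw [← map_add (M i), ← hcoord s hs.1 i,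
        (hD (J (S (Vt s))) (Vt s)).1 ⟨S (Vt s), rfl, hBS _⟩ i]
    rw [hcong, hftc]
    simp [expFlow_zero]
  refine ⟨fun t => S (Vt t), fun t ht => ?_, (S.continuous.comp hVtc).continuousOn,
    fun t ht => ?_, ?_⟩
  · rw [hJV t ht.1]
    congr 1
    refine intervalIntegral.integral_congr fun s hs => ?_
    simp only [hsub t ht s hs]
  · have hd : HasDerivAt (fun t => J F₀ + ∫ s in (0 : ℝ)..t, (Vt s + J (F s)))
        (Vt t + J (F t)) t :=
      (intervalIntegral.integral_hasDerivAt_right (hcI.intervalIntegrable _ _)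
        (hcI.stronglyMeasurableAtFilter _ _) hcI.continuousAt).const_add _
    have ht' : t ∈ Icc 0 T₀ := ⟨ht.1.le, ht.2⟩
    rw [hBS, ← hFF t ht']
    exact hd.hasDerivWithinAt.congr (fun s hs => hint s hs.1) (hint t ht'.1)
  · have h0 : T 0 (B F₀) = B F₀ := by
      rw [hT, (isContractionSemigroup_blockSemigroup W hM).zero]; rfl
    simp only [hVt, h0, intervalIntegral.integral_same, add_zero, hSB]

end Mild
end BlockSemigroup

/-! ### The modes of the damped wave equation -/

/-- Gronwall's inequality in the form used for energy functionals. -/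
theorem le_exp_mul_of_deriv_le {L L' : ℝ → ℝ} {k : ℝ} (hL : ∀ t, HasDerivAt L (L' t) t)
    (h : ∀ t, L' t ≤ -k * L t) {t : ℝ} (ht : 0 ≤ t) : L t ≤ Real.exp (-k * t) * L 0 := by
  have hd : ∀ t, HasDerivAt (fun t => Real.exp (k * t) * L t)
      (Real.exp (k * t) * (k * 1) * L t + Real.exp (k * t) * L' t) t := fun t =>
    (((hasDerivAt_id t).const_mul k).exp).mul (hL t)
  have hanti : Antitone fun t => Real.exp (k * t) * L t := by
    refine antitone_of_deriv_nonpos (fun t => (hd t).differentiableAt) fun t => ?_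
    rw [(hd t).deriv]
    nlinarith [h t, Real.exp_pos (k * t)]
  have h1 := hanti ht
  simp only [mul_zero, Real.exp_zero, one_mul] at h1
  calc L t = Real.exp (-k * t) * (Real.exp (k * t) * L t) := by
        rw [← mul_assoc, ← Real.exp_add]; simp
    _ ≤ _ := by gcongr

section Blocks
variable {𝕜 : Type*} [RCLike 𝕜]

/-- The operator on `𝕜²` with matrix `[[a, b], [c, d]]`. -/
noncomputable def mat2 (a b c d : 𝕜) : WithLp 2 (𝕜 × 𝕜) →L[𝕜] WithLp 2 (𝕜 × 𝕜) :=
  LinearMap.toContinuousLinearMap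
    { toFun := fun x => WithLp.toLp 2 (a * x.fst + b * x.snd, c * x.fst + d * x.snd)
      map_add' := fun x y => by
        apply WithLp.ofLp_injective
        ext <;> simp <;> ring
      map_smul' := fun r x => by
        apply WithLp.ofLp_injective
        ext <;> simp <;> ring }

theorem mat2_apply (a b c d : 𝕜) (x : WithLp 2 (𝕜 × 𝕜)) :
    mat2 a b c d x = WithLp.toLp 2 (a * x.fst + b * x.snd, c * x.fst + d * x.snd) := rfl

theorem norm_mat2_le (a b c d : 𝕜) : ‖mat2 a b c d‖ ≤ ‖a‖ + ‖b‖ + ‖c‖ + ‖d‖ := by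
  refine ContinuousLinearMap.opNorm_le_bound _ (by positivity) fun x => ?_
  have h1 : ‖x.fst‖ ≤ ‖x‖ := WithLp.norm_fst_le _ x
  have h2 : ‖x.snd‖ ≤ ‖x‖ := WithLp.norm_snd_le _ x
  have h3 := WithLp.prod_norm_sq_eq_of_L2 (mat2 a b c d x)
  have h4 : ‖(mat2 a b c d x).fst‖ ≤ (‖a‖ + ‖b‖) * ‖x‖ := by
    refine (norm_add_le _ _).trans ?_
    rw [norm_mul, norm_mul, add_mul]
    gcongr
  have h5 : ‖(mat2 a b c d x).snd‖ ≤ (‖c‖ + ‖d‖) * ‖x‖ := by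
    refine (norm_add_le _ _).trans ?_
    rw [norm_mul, norm_mul, add_mul]
    gcongr
  have h6 : ‖mat2 a b c d x‖ ≤ ‖(mat2 a b c d x).fst‖ + ‖(mat2 a b c d x).snd‖ := by
    refine abs_le_of_sq_le_sq' ?_ (by positivity) |>.2
    nlinarith [norm_nonneg (mat2 a b c d x).fst, norm_nonneg (mat2 a b c d x).snd]
  linarith

/-- The damped-wave operator on a single mode: the matrix `[[0, s], [-s, -ν]]`. -/
noncomputable def waveBlock (s ν : ℝ) : WithLp 2 (𝕜 × 𝕜) →L[𝕜] WithLp 2 (𝕜 × 𝕜) :=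
  mat2 0 (s : 𝕜) (-(s : 𝕜)) (-(ν : 𝕜))

theorem waveBlock_apply (s ν : ℝ) (x : WithLp 2 (𝕜 × 𝕜)) :
    waveBlock s ν x = WithLp.toLp 2 ((s : 𝕜) * x.snd, -(s : 𝕜) * x.fst - (ν : 𝕜) * x.snd) := by
  simp [waveBlock, mat2_apply, sub_eq_add_neg]

theorem waveBlock_toLp (s ν : ℝ) (p q : 𝕜) :
    waveBlock s ν (WithLp.toLp 2 (p, q)) =
      WithLp.toLp 2 ((s : 𝕜) * q, -(s : 𝕜) * p - (ν : 𝕜) * q) := waveBlock_apply s ν _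

/-- The resolvent of a wave block, given by Cramer's rule. -/
noncomputable def waveBlockResolvent (s ν : ℝ) (z : 𝕜) :
    WithLp 2 (𝕜 × 𝕜) →L[𝕜] WithLp 2 (𝕜 × 𝕜) :=
  mat2 ((z + ν) / (z ^ 2 + ν * z + s ^ 2)) (s / (z ^ 2 + ν * z + s ^ 2))
    (-s / (z ^ 2 + ν * z + s ^ 2)) (z / (z ^ 2 + ν * z + s ^ 2))

theorem waveBlockResolvent_left {s ν : ℝ} {z : 𝕜} (h : z ^ 2 + ν * z + (s : 𝕜) ^ 2 ≠ 0)
    (x : WithLp 2 (𝕜 × 𝕜)) : waveBlockResolvent s ν z (z • x - waveBlock s ν x) = x := by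
  apply WithLp.ofLp_injective
  unfold waveBlockResolvent
  generalize hd : z ^ 2 + ν * z + (s : 𝕜) ^ 2 = d at h ⊢
  ext <;> simp [waveBlock, mat2_apply] <;> field_simp <;> rw [← hd] <;> ring

theorem waveBlockResolvent_right {s ν : ℝ} {z : 𝕜} (h : z ^ 2 + ν * z + (s : 𝕜) ^ 2 ≠ 0)
    (x : WithLp 2 (𝕜 × 𝕜)) :
    z • waveBlockResolvent s ν z x - waveBlock s ν (waveBlockResolvent s ν z x) = x := by
  apply WithLp.ofLp_injective
  unfold waveBlockResolvent
  generalize hd : z ^ 2 + ν * z + (s : 𝕜) ^ 2 = d at h ⊢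
  ext <;> simp [waveBlock, mat2_apply] <;> field_simp <;> rw [← hd] <;> ring

/-- For frequencies tending to infinity, the resolvents of the wave blocks are `O(1 / s)`, and in
particular uniformly bounded. -/
theorem exists_waveBlockResolvent_bound {s : ℕ → ℝ} (hs : Tendsto s atTop atTop) (ν : ℝ) (z : 𝕜) :
    ∃ C : ℝ, 0 ≤ C ∧ ∀ n, ‖waveBlockResolvent (s n) ν z‖ ≤ C := by
  set A := ‖z + ν‖ + ‖z‖ with hA
  set c := ‖z ^ 2 + ν * z‖ with hc
  have hev : ∀ᶠ n in atTop, ‖waveBlockResolvent (s n) ν z‖ ≤ 2 * (A + 2) := by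
    filter_upwards [hs.eventually_ge_atTop (2 * c + 1)] with n hn
    have hc0 : 0 ≤ c := norm_nonneg _
    have hs1 : 1 ≤ s n := by linarith
    have hs0 : 0 < s n := by linarith
    have hd : s n / 2 ≤ ‖z ^ 2 + ν * z + (s n : 𝕜) ^ 2‖ := by
      have h1 := norm_sub_le_norm_add ((s n : 𝕜) ^ 2) (z ^ 2 + ν * z)
      rw [norm_pow, RCLike.norm_ofReal, sq_abs, add_comm ((s n : 𝕜) ^ 2), ← hc] at h1
      nlinarith
    have hd0 : 0 < ‖z ^ 2 + ν * z + (s n : 𝕜) ^ 2‖ := by linarith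
    refine (norm_mat2_le _ _ _ _).trans ?_
    simp only [norm_div, norm_neg, RCLike.norm_ofReal, abs_of_pos hs0]
    rw [← add_div, ← add_div, ← add_div, div_le_iff₀ hd0]
    have hA0 : 0 ≤ A := by positivity
    have h2 : (A + 2) * s n ≤ 2 * (A + 2) * ‖z ^ 2 + ν * z + (s n : 𝕜) ^ 2‖ := by nlinarith
    nlinarith
  obtain ⟨C, hC⟩ := (IsBoundedUnder.bddAbove_range ⟨2 * (A + 2), by simpa using hev⟩ :
    BddAbove (range fun n => ‖waveBlockResolvent (s n) ν z‖))
  exact ⟨C, (norm_nonneg _).trans (hC ⟨0, rfl⟩), fun n => hC ⟨n, rfl⟩⟩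

variable (s ν : ℝ) (x : WithLp 2 (𝕜 × 𝕜))

theorem hasDerivAt_fst_expFlow (t : ℝ) :
    HasDerivAt (fun t => (expFlow (waveBlock s ν) t x).fst)
      ((s : 𝕜) * (expFlow (waveBlock s ν) t x).snd) t := by
  have h := ((WithLp.fstL 2 ℝ 𝕜 𝕜).hasFDerivAt.comp_hasDerivAt t
    (hasDerivAt_expFlow_apply (waveBlock s ν) x t))
  rw [waveBlock_apply] at h
  exact h

theorem hasDerivAt_snd_expFlow (t : ℝ) :
    HasDerivAt (fun t => (expFlow (waveBlock s ν) t x).snd)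
      (-(s : 𝕜) * (expFlow (waveBlock s ν) t x).fst
        - (ν : 𝕜) * (expFlow (waveBlock s ν) t x).snd) t := by
  have h := ((WithLp.sndL 2 ℝ 𝕜 𝕜).hasFDerivAt.comp_hasDerivAt t
    (hasDerivAt_expFlow_apply (waveBlock s ν) x t))
  rw [waveBlock_apply] at h
  exact h

theorem hasDerivAt_re_inner {f g : ℝ → 𝕜} {f' g' : 𝕜} {t : ℝ} (hf : HasDerivAt f f' t)
    (hg : HasDerivAt g g' t) :
    HasDerivAt (fun t => RCLike.re (inner 𝕜 (f t) (g t)))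
      (RCLike.re (inner 𝕜 (f t) g' + inner 𝕜 f' (g t))) t :=
  (RCLike.reCLM (K := 𝕜)).hasFDerivAt.comp_hasDerivAt t (hf.inner 𝕜 hg)

/-- The energy of a mode is dissipated through its velocity component only. -/
theorem hasDerivAt_energy (t : ℝ) :
    HasDerivAt (fun t => ‖expFlow (waveBlock s ν) t x‖ ^ 2)
      (-2 * ν * ‖(expFlow (waveBlock s ν) t x).snd‖ ^ 2) t := by
  have hp := hasDerivAt_fst_expFlow s ν x t
  have hq := hasDerivAt_snd_expFlow s ν x t
  have h := (hasDerivAt_re_inner hp hp).add (hasDerivAt_re_inner hq hq)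
  have h1 : (fun t => ‖expFlow (waveBlock s ν) t x‖ ^ 2) =
      (fun t => RCLike.re (inner 𝕜 (expFlow (waveBlock s ν) t x).fst
        (expFlow (waveBlock s ν) t x).fst)) + (fun t => RCLike.re
        (inner 𝕜 (expFlow (waveBlock s ν) t x).snd (expFlow (waveBlock s ν) t x).snd)) := by
    funext t
    rw [WithLp.prod_norm_sq_eq_of_L2, Pi.add_apply, inner_self_eq_norm_sq, inner_self_eq_norm_sq]
  rw [h1]
  convert! h using 1
  rw [← inner_self_eq_norm_sq (𝕜 := 𝕜)]
  set p := (expFlow (waveBlock s ν) t x).fst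
  set q := (expFlow (waveBlock s ν) t x).snd
  simp only [RCLike.inner_apply, map_add, map_sub, map_neg, map_mul, RCLike.mul_re, RCLike.mul_im,
    RCLike.conj_re, RCLike.conj_im, RCLike.ofReal_re, RCLike.ofReal_im, RCLike.conj_ofReal]
  ring

/-- The mixed term of the Lyapunov functional. -/
theorem hasDerivAt_mixed (t : ℝ) :
    HasDerivAt (fun t => RCLike.re (inner 𝕜 (expFlow (waveBlock s ν) t x).fst
        (expFlow (waveBlock s ν) t x).snd))
      (s * ‖(expFlow (waveBlock s ν) t x).snd‖ ^ 2 - s * ‖(expFlow (waveBlock s ν) t x).fst‖ ^ 2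
        - ν * RCLike.re (inner 𝕜 (expFlow (waveBlock s ν) t x).fst
        (expFlow (waveBlock s ν) t x).snd)) t := by
  convert! hasDerivAt_re_inner (hasDerivAt_fst_expFlow s ν x t)
    (hasDerivAt_snd_expFlow s ν x t) using 1
  rw [← inner_self_eq_norm_sq (𝕜 := 𝕜), ← inner_self_eq_norm_sq (𝕜 := 𝕜)]
  set p := (expFlow (waveBlock s ν) t x).fst
  set q := (expFlow (waveBlock s ν) t x).snd
  simp only [RCLike.inner_apply, map_add, map_sub, map_neg, map_mul, RCLike.mul_re, RCLike.mul_im,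
    RCLike.conj_re, RCLike.conj_im, RCLike.ofReal_re, RCLike.ofReal_im, RCLike.conj_ofReal]
  ring

variable {ν}

theorem norm_expFlow_waveBlock_le_one (hν : 0 < ν) {t : ℝ} (ht : 0 ≤ t) :
    ‖expFlow (waveBlock (𝕜 := 𝕜) s ν) t‖ ≤ 1 := by
  refine ContinuousLinearMap.opNorm_le_bound _ zero_le_one fun x => ?_
  have h := le_exp_mul_of_deriv_le (k := 0) (hasDerivAt_energy s ν x)
    (fun t => by have := mul_nonneg hν.le (sq_nonneg ‖(expFlow (waveBlock s ν) t x).snd‖); linarith)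
    ht
  rw [one_mul]
  refine abs_le_of_sq_le_sq' ?_ (norm_nonneg _) |>.2
  simpa [expFlow_zero] using h

/-- Uniform exponential decay of the modes. With `p`, `q` the two components, the functional
`‖p‖² + ‖q‖² + (2ε/s) Re ⟪p, q⟫` is comparable to the energy and, for small `ε`, decays
exponentially at a rate which depends only on `ν` and a lower bound for `s`. -/
theorem exists_norm_expFlow_waveBlock_le (hν : 0 < ν) {s₁ : ℝ} (hs₁ : 0 < s₁) :
    ∃ δ : ℝ, 0 < δ ∧ ∀ s, s₁ ≤ s → ∀ t, 0 ≤ t →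
      ‖expFlow (waveBlock (𝕜 := 𝕜) s ν) t‖ ≤ 2 * Real.exp (-δ * t) := by
  obtain ⟨ε, hε, hε1, hε2⟩ : ∃ ε : ℝ, 0 < ε ∧ ε ≤ s₁ / 2 ∧ ε * (3 + ν ^ 2 / s₁ ^ 2) ≤ 2 * ν := by
    refine ⟨min (s₁ / 2) (2 * ν / (3 + ν ^ 2 / s₁ ^ 2)), by positivity, min_le_left _ _, ?_⟩
    have h3 : 0 < 3 + ν ^ 2 / s₁ ^ 2 := by positivity
    calc _ ≤ 2 * ν / (3 + ν ^ 2 / s₁ ^ 2) * (3 + ν ^ 2 / s₁ ^ 2) := by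
          gcongr; exact min_le_right _ _
      _ = 2 * ν := by field_simp
  refine ⟨ε / 3, by positivity, fun s hs t ht => ?_⟩
  have hs0 : 0 < s := hs₁.trans_le hs
  refine ContinuousLinearMap.opNorm_le_bound _ (by positivity) fun x => ?_
  set X : ℝ → WithLp 2 (𝕜 × 𝕜) := fun t => expFlow (waveBlock s ν) t x with hX
  set R : ℝ → ℝ := fun t => RCLike.re (inner 𝕜 (X t).fst (X t).snd) with hR
  have hE : ∀ t, ‖X t‖ ^ 2 = ‖(X t).fst‖ ^ 2 + ‖(X t).snd‖ ^ 2 := fun t =>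
    WithLp.prod_norm_sq_eq_of_L2 _
  have hRle : ∀ t, |R t| ≤ ‖(X t).fst‖ * ‖(X t).snd‖ := fun t =>
    (RCLike.abs_re_le_norm _).trans (norm_inner_le_norm _ _)
  set c := 2 * ε / s with hc
  have hcs : c * s = 2 * ε := by rw [hc]; field_simp
  have hc0 : 0 < c := by positivity
  have hc1 : c ≤ 1 := by rw [hc, div_le_one hs0]; linarith
  have hcR : ∀ t, |c * R t| ≤ ‖X t‖ ^ 2 / 2 := fun t => by
    rw [abs_mul, abs_of_pos hc0, hE]
    nlinarith [hRle t, abs_nonneg (R t), sq_nonneg (‖(X t).fst‖ - ‖(X t).snd‖)]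
  have hL : ∀ t, HasDerivAt (fun t => ‖X t‖ ^ 2 + c * R t)
      (-2 * ν * ‖(X t).snd‖ ^ 2 +
        c * (s * ‖(X t).snd‖ ^ 2 - s * ‖(X t).fst‖ ^ 2 - ν * R t)) t := fun t =>
    (hasDerivAt_energy s ν x t).add ((hasDerivAt_mixed s ν x t).const_mul c)
  have hdiss : ∀ t, -2 * ν * ‖(X t).snd‖ ^ 2 +
      c * (s * ‖(X t).snd‖ ^ 2 - s * ‖(X t).fst‖ ^ 2 - ν * R t) ≤
      -(2 * ε / 3) * (‖X t‖ ^ 2 + c * R t) := by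
    intro t
    have h1 := (abs_le.1 (hcR t)).2
    have hP := sq_nonneg ‖(X t).fst‖
    have hQ := sq_nonneg ‖(X t).snd‖
    -- Young's inequality for the cross term, weighted so that half of the `‖p‖²` term survives.
    have h2 : -(c * ν * R t) ≤ ε * ‖(X t).fst‖ ^ 2 + ε * (ν ^ 2 / s₁ ^ 2) * ‖(X t).snd‖ ^ 2 := by
      have h3 : c ≤ 2 * ε / s₁ := by rw [hc]; gcongr
      have h4 : -R t ≤ ‖(X t).fst‖ * ‖(X t).snd‖ := (neg_le_abs _).trans (hRle t)
      calc -(c * ν * R t) = c * ν * (-R t) := by ring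
        _ ≤ c * ν * (‖(X t).fst‖ * ‖(X t).snd‖) := by gcongr
        _ ≤ 2 * ε / s₁ * ν * (‖(X t).fst‖ * ‖(X t).snd‖) := by gcongr
        _ = ε * (2 * ‖(X t).fst‖ * (ν / s₁ * ‖(X t).snd‖)) := by ring
        _ ≤ ε * (‖(X t).fst‖ ^ 2 + (ν / s₁ * ‖(X t).snd‖) ^ 2) := by
            gcongr; exact two_mul_le_add_sq _ _
        _ = _ := by ring
    have h5 : -2 * ν * ‖(X t).snd‖ ^ 2 +
        c * (s * ‖(X t).snd‖ ^ 2 - s * ‖(X t).fst‖ ^ 2 - ν * R t) =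
        -2 * ν * ‖(X t).snd‖ ^ 2 + 2 * ε * ‖(X t).snd‖ ^ 2 - 2 * ε * ‖(X t).fst‖ ^ 2
          + -(c * ν * R t) := by rw [← hcs]; ring
    have h6 : ε * (3 + ν ^ 2 / s₁ ^ 2) * ‖(X t).snd‖ ^ 2 ≤ 2 * ν * ‖(X t).snd‖ ^ 2 := by gcongr
    have h7 : ε * (c * R t) ≤ ε * (‖X t‖ ^ 2 / 2) := by gcongr
    rw [h5]
    rw [hE] at h7 ⊢
    linarith
  have hdecay := le_exp_mul_of_deriv_le hL hdiss ht
  have h0 : X 0 = x := by simp [hX, expFlow_zero]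
  have h8 := (abs_le.1 (hcR t)).1
  have h9 := (abs_le.1 (hcR 0)).2
  rw [h0] at h9 hdecay
  refine abs_le_of_sq_le_sq' ?_ (by positivity) |>.2
  have hexp : Real.exp (-(ε / 3) * t) ^ 2 = Real.exp (-(2 * ε / 3) * t) := by
    rw [← Real.exp_nat_mul]; congr 1; push_cast; ring
  rw [mul_pow, mul_pow, hexp]
  have h10 : Real.exp (-(2 * ε / 3) * t) * (‖x‖ ^ 2 + c * R 0) ≤
      Real.exp (-(2 * ε / 3) * t) * (3 / 2 * ‖x‖ ^ 2) := by
    gcongr; linarith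
  have h11 : 0 ≤ Real.exp (-(2 * ε / 3) * t) * ‖x‖ ^ 2 := by positivity
  change ‖X t‖ ^ 2 ≤ _
  linarith

end Blocks

/-! ### The number `θ` and the roots of the characteristic equation -/

section Theta

theorem neg_half_le_theta {κ : ℝ} (hκ : 0 < κ) (ν : ℝ) : -ν / 2 ≤ theta κ ν := by
  by_cases h : ∀ n : ℕ, 1 ≤ n → 0 ≤ thetaSeq κ ν n
  · rw [theta, if_pos h]
  · obtain ⟨n, -, -, hr⟩ := (theta_isGreatest hκ h).1
    rw [hr]
    linarith [Real.sqrt_nonneg (ν ^ 2 - (n : ℝ) ^ 2 * Real.pi ^ 2 * κ)]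

theorem theta_neg {κ ν : ℝ} (hκ : 0 < κ) (hν : 0 < ν) : theta κ ν < 0 := by
  by_cases h : ∀ n : ℕ, 1 ≤ n → 0 ≤ thetaSeq κ ν n
  · rw [theta, if_pos h]; linarith
  · obtain ⟨n, hn, -, hr⟩ := (theta_isGreatest hκ h).1
    rw [hr]
    have hn' : (0 : ℝ) < n := by exact_mod_cast hn
    have : √(ν ^ 2 - (n : ℝ) ^ 2 * Real.pi ^ 2 * κ) < ν := by
      rw [Real.sqrt_lt' hν]
      have : 0 < (n : ℝ) ^ 2 * Real.pi ^ 2 * κ := by positivity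
      linarith
    linarith

/-- The roots of `z² + ν z + s² = 0`, where `s² = κ (n π / 2)²`, have real part at most `θ`. -/
theorem charPoly_ne_zero {𝕜 : Type*} [RCLike 𝕜] {κ ν : ℝ} (hκ : 0 < κ) {z : 𝕜}
    (hz : theta κ ν < RCLike.re z) {n : ℕ} (hn : 1 ≤ n) {s : ℝ}
    (hs : s ^ 2 = κ * (n * Real.pi / 2) ^ 2) : z ^ 2 + ν * z + (s : 𝕜) ^ 2 ≠ 0 := by
  intro h0
  set a := RCLike.re z
  set b := RCLike.im z
  have hre : a * a - b * b + ν * a + s * s = 0 := by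
    have := congrArg RCLike.re h0
    simpa [pow_two, RCLike.mul_re] using this
  have him : a * b + b * a + ν * b = 0 := by
    have := congrArg RCLike.im h0
    simpa [pow_two, RCLike.mul_re, RCLike.mul_im, add_comm, mul_comm] using this
  have ha : -ν / 2 < a := (neg_half_le_theta hκ ν).trans_lt hz
  have hb : b = 0 := by
    have : b * (2 * a + ν) = 0 := by linarith
    rcases mul_eq_zero.1 this with h | h
    · exact h
    · linarith
  have hdisc : (2 * a + ν) ^ 2 = ν ^ 2 - (n : ℝ) ^ 2 * Real.pi ^ 2 * κ := by
    rw [hb] at hre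
    linear_combination 4 * hre - 4 * hs
  have hpos : 0 < (2 * a + ν) ^ 2 := by
    have : 0 < 2 * a + ν := by linarith
    positivity
  have hneg : thetaSeq κ ν n < 0 := by unfold thetaSeq; linarith
  have hcase : ¬ ∀ n : ℕ, 1 ≤ n → 0 ≤ thetaSeq κ ν n := fun h => (h n hn).not_gt hneg
  have hle := (theta_isGreatest hκ hcase).2 ⟨n, hn, hneg, rfl⟩
  rw [← hdisc, Real.sqrt_sq (by linarith)] at hle
  linarith

end Theta

/-! ### Weak derivatives and `H¹₀(I)` -/

section Sobolev
variable {𝕜 : Type*} [RCLike 𝕜]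

theorem memLp_of_continuous {f : ℝ → 𝕜} (hf : Continuous f) :
    MemLp f 2 (volume.restrict (Ioo (-1 : ℝ) 1)) := by
  obtain ⟨C, hC⟩ := isCompact_Icc.exists_bound_of_continuousOn (s := Icc (-1 : ℝ) 1) hf.continuousOn
  refine MemLp.of_bound hf.aestronglyMeasurable C ?_
  filter_upwards [ae_restrict_mem measurableSet_Ioo] with x hx using hC x (Ioo_subset_Icc_self hx)

/-- A continuous function on the line, restricted to `I`, as an element of `L²(I)`. -/
noncomputable def toL2 (f : ℝ → 𝕜) (hf : Continuous f) : L2 𝕜 := (memLp_of_continuous hf).toLp f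

theorem coeFn_toL2 {f : ℝ → 𝕜} (hf : Continuous f) :
    toL2 f hf =ᵐ[volume.restrict (Ioo (-1 : ℝ) 1)] f := MemLp.coeFn_toLp _

theorem inner_eq_integral (u v : L2 𝕜) :
    inner 𝕜 u v = ∫ x in Ioo (-1 : ℝ) 1, v x * (starRingEnd 𝕜) (u x) := by
  rw [L2.inner_def]
  simp only [RCLike.inner_apply]

theorem inner_eq_integral_of_ae {u v : L2 𝕜} {f : ℝ → 𝕜}
    (hf : u =ᵐ[volume.restrict (Ioo (-1 : ℝ) 1)] f) :
    inner 𝕜 u v = ∫ x in Ioo (-1 : ℝ) 1, v x * (starRingEnd 𝕜) (f x) := by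
  rw [inner_eq_integral]
  refine integral_congr_ae ?_
  filter_upwards [hf] with x hx
  rw [hx]

theorem toL2_sub {f g : ℝ → 𝕜} (hf : Continuous f) (hg : Continuous g) :
    toL2 (f - g) (hf.sub hg) = toL2 f hf - toL2 g hg := rfl

theorem norm_toL2_sq {f : ℝ → 𝕜} (hf : Continuous f) :
    ‖toL2 f hf‖ ^ 2 = ∫ x in Ioo (-1 : ℝ) 1, ‖f x‖ ^ 2 := by
  rw [← inner_self_eq_norm_sq (𝕜 := 𝕜), inner_eq_integral,
    ← RCLike.ofReal_re (K := 𝕜) (∫ x in Ioo (-1 : ℝ) 1, ‖f x‖ ^ 2), ← integral_ofReal]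
  congr 1
  refine integral_congr_ae ?_
  filter_upwards [coeFn_toL2 hf] with x h
  rw [h, RCLike.mul_conj]
  push_cast
  rfl

theorem deriv_conj (φ : ℝ → 𝕜) (hφ : Differentiable ℝ φ) (x : ℝ) :
    deriv (fun x => (starRingEnd 𝕜) (φ x)) x = (starRingEnd 𝕜) (deriv φ x) :=
  ((RCLike.conjCLE (K := 𝕜)).toContinuousLinearMap.hasFDerivAt.comp_hasDerivAt x
    (hφ x).hasDerivAt).deriv

theorem IsTestFunction.differentiable {φ : ℝ → 𝕜} (h : IsTestFunction φ) :
    Differentiable ℝ φ := h.smooth.differentiable (by simp)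

theorem IsTestFunction.conj {φ : ℝ → 𝕜} (h : IsTestFunction φ) :
    IsTestFunction fun x => (starRingEnd 𝕜) (φ x) :=
  ⟨(RCLike.conjCLE (K := 𝕜)).toContinuousLinearMap.contDiff.comp h.smooth,
    h.compact.comp_left (map_zero _), (tsupport_comp_subset (map_zero _) φ).trans h.support⟩

theorem toL2_mem_testPairs {φ : ℝ → 𝕜} (h : IsTestFunction φ) :
    (toL2 φ h.smooth.continuous, toL2 (deriv φ) h.deriv_continuous) ∈ testPairs 𝕜 :=
  ⟨φ, h, coeFn_toL2 h.smooth.continuous, coeFn_toL2 h.deriv_continuous⟩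

/-- The weak derivative in terms of the inner product of `L²(I)`. -/
theorem hasWeakDeriv_iff_inner {u g : L2 𝕜} :
    HasWeakDeriv u g ↔ ∀ p ∈ testPairs 𝕜, inner 𝕜 p.2 u = -inner 𝕜 p.1 g := by
  constructor
  · rintro h p ⟨φ, hφ, h1, h2⟩
    rw [inner_eq_integral_of_ae h1, inner_eq_integral_of_ae h2, ← h _ hφ.conj]
    simp only [deriv_conj φ hφ.differentiable]
  · intro h φ hφ
    have := h _ (toL2_mem_testPairs hφ.conj)
    rw [inner_eq_integral_of_ae (coeFn_toL2 _), inner_eq_integral_of_ae (coeFn_toL2 _)] at this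
    simpa only [deriv_conj φ hφ.differentiable, RCLike.conj_conj] using this

/-- Integration by parts against a limit of test functions. -/
theorem inner_closure_testPairs {u g : L2 𝕜} (h : HasWeakDeriv u g) {p : L2 𝕜 × L2 𝕜}
    (hp : p ∈ (testPairs 𝕜).topologicalClosure) : inner 𝕜 p.2 u = -inner 𝕜 p.1 g := by
  have hcl : IsClosed {p : L2 𝕜 × L2 𝕜 | inner 𝕜 p.2 u = -inner 𝕜 p.1 g} :=
    isClosed_eq (by fun_prop) (by fun_prop)
  exact closure_minimal (fun q hq => hasWeakDeriv_iff_inner.1 h q hq) hcl hp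

/-- A classical derivative is a weak derivative. -/
theorem hasWeakDeriv_of_hasDerivAt {u g : L2 𝕜} {f f' : ℝ → 𝕜}
    (hu : u =ᵐ[volume.restrict (Ioo (-1 : ℝ) 1)] f)
    (hg : g =ᵐ[volume.restrict (Ioo (-1 : ℝ) 1)] f')
    (hf : ∀ x, HasDerivAt f (f' x) x) (hc' : Continuous f') : HasWeakDeriv u g := by
  intro φ hφ
  have h1 : ∫ x in Ioo (-1 : ℝ) 1, u x * deriv φ x = ∫ x in (-1 : ℝ)..1, f x * deriv φ x := by
    rw [intervalIntegral.integral_of_le (by norm_num), integral_Ioc_eq_integral_Ioo]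
    refine integral_congr_ae ?_
    filter_upwards [hu] with x hx
    rw [hx]
  have h2 : ∫ x in Ioo (-1 : ℝ) 1, g x * φ x = ∫ x in (-1 : ℝ)..1, f' x * φ x := by
    rw [intervalIntegral.integral_of_le (by norm_num), integral_Ioc_eq_integral_Ioo]
    refine integral_congr_ae ?_
    filter_upwards [hg] with x hx
    rw [hx]
  have h0 : ∀ x, x ∉ Ioo (-1 : ℝ) 1 → φ x = 0 := fun x hx => by
    by_contra hne
    exact hx (hφ.support (subset_tsupport φ hne))
  rw [h1, h2, intervalIntegral.integral_mul_deriv_eq_deriv_mul (fun x _ => hf x)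
    (fun x _ => (hφ.differentiable x).hasDerivAt) (hc'.intervalIntegrable _ _)
    (hφ.deriv_continuous.intervalIntegrable _ _), h0 1 (by simp), h0 (-1) (by simp)]
  simp

theorem hasWeakDeriv_toL2 {f f' : ℝ → 𝕜} (hf : ∀ x, HasDerivAt f (f' x) x) (hc : Continuous f)
    (hc' : Continuous f') : HasWeakDeriv (toL2 f hc) (toL2 f' hc') :=
  hasWeakDeriv_of_hasDerivAt (coeFn_toL2 hc) (coeFn_toL2 hc') hf hc'

/-- Weak differentiability passes to limits in `L²(I) × L²(I)`. -/
theorem hasWeakDeriv_of_mem_closure {p : L2 𝕜 × L2 𝕜} (hp : p ∈ (testPairs 𝕜).topologicalClosure) :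
    HasWeakDeriv p.1 p.2 := by
  rw [hasWeakDeriv_iff_inner]
  intro q hq
  have hcl : IsClosed {p : L2 𝕜 × L2 𝕜 | inner 𝕜 q.2 p.1 = -inner 𝕜 q.1 p.2} :=
    isClosed_eq (by fun_prop) (by fun_prop)
  have hsub : (testPairs 𝕜 : Set (L2 𝕜 × L2 𝕜)) ⊆
      {p | inner 𝕜 q.2 p.1 = -inner 𝕜 q.1 p.2} := by
    rintro p ⟨φ, hφ, h1, h2⟩
    exact hasWeakDeriv_iff_inner.1 (hasWeakDeriv_of_hasDerivAt h1 h2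
      (fun x => (hφ.differentiable x).hasDerivAt) hφ.deriv_continuous) q hq
  exact closure_minimal hsub hcl hp

section H10
variable (κ : ℝ) [hκ : Fact (0 < κ)]

omit hκ in
theorem mem_closure_testPairs (w : H10 𝕜 κ) :
    ((H10.toH1 𝕜 κ w : L2 𝕜), weakDeriv 𝕜 (H10.toH1 𝕜 κ w)) ∈ (testPairs 𝕜).topologicalClosure :=
  w.2

omit hκ in
/-- Every limit of pairs `(φ, φ')` is a pair `(w, w')` with `w ∈ H¹₀(I)`. -/
theorem exists_H10_of_mem_closure {p : L2 𝕜 × L2 𝕜} (hp : p ∈ (testPairs 𝕜).topologicalClosure) :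
    ∃ w : H10 𝕜 κ, (H10.toH1 𝕜 κ w : L2 𝕜) = p.1 ∧ weakDeriv 𝕜 (H10.toH1 𝕜 κ w) = p.2 := by
  have hd := hasWeakDeriv_of_mem_closure hp
  set u : H1 𝕜 := ⟨p.1, p.2, hd⟩ with hu
  have h2 : weakDeriv 𝕜 u = p.2 := (weakDeriv_spec u).unique hd
  have h3 : u ∈ H10sub 𝕜 := by
    change ((u : L2 𝕜), weakDeriv 𝕜 u) ∈ (testPairs 𝕜).topologicalClosure
    rw [h2]
    exact hp
  exact ⟨⟨u, h3⟩, rfl, h2⟩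

omit hκ in
theorem H10_ext {u w : H10 𝕜 κ} (h : (H10.toH1 𝕜 κ u : L2 𝕜) = H10.toH1 𝕜 κ w) : u = w :=
  Subtype.ext (Subtype.ext h)

omit hκ in
/-- Integration by parts: there are no boundary terms for `w ∈ H¹₀(I)`. -/
theorem inner_weakDeriv_H10 {u g : L2 𝕜} (h : HasWeakDeriv u g) (w : H10 𝕜 κ) :
    inner 𝕜 (weakDeriv 𝕜 (H10.toH1 𝕜 κ w)) u = -inner 𝕜 (H10.toH1 𝕜 κ w : L2 𝕜) g :=
  inner_closure_testPairs h (mem_closure_testPairs κ w)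

omit hκ in
/-- The weak derivative may be tested with `H¹₀(I)` instead of test functions. -/
theorem hasWeakDeriv_of_inner_H10 {u g : L2 𝕜} (h : ∀ w : H10 𝕜 κ,
    inner 𝕜 (weakDeriv 𝕜 (H10.toH1 𝕜 κ w)) u = -inner 𝕜 (H10.toH1 𝕜 κ w : L2 𝕜) g) :
    HasWeakDeriv u g := by
  rw [hasWeakDeriv_iff_inner]
  intro p hp
  obtain ⟨w, h1, h2⟩ := exists_H10_of_mem_closure κ
    (Submodule.le_topologicalClosure (testPairs 𝕜) hp)
  rw [← h1, ← h2, h w]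

theorem norm_H10 (w : H10 𝕜 κ) : ‖w‖ = √κ * ‖weakDeriv 𝕜 (H10.toH1 𝕜 κ w)‖ := by
  change ‖((√κ : ℝ) : 𝕜) • weakDeriv 𝕜 (H10.toH1 𝕜 κ w)‖ = _
  rw [norm_smul, RCLike.norm_ofReal, abs_of_nonneg (Real.sqrt_nonneg _)]

theorem norm_weakDeriv_H10 (w : H10 𝕜 κ) :
    ‖weakDeriv 𝕜 (H10.toH1 𝕜 κ w)‖ = (√κ)⁻¹ * ‖w‖ := by
  have : 0 < √κ := Real.sqrt_pos.2 hκ.out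
  rw [norm_H10, inv_mul_cancel_left₀ this.ne']

theorem norm_toH1_le (w : H10 𝕜 κ) : ‖(H10.toH1 𝕜 κ w : L2 𝕜)‖ ≤ 2 * (√κ)⁻¹ * ‖w‖ := by
  rw [mul_assoc, ← norm_weakDeriv_H10]
  exact poincare _ w.2

/-- The inclusion `H¹₀(I) → L²(I)` as a bounded operator. -/
noncomputable def inclL2 : H10 𝕜 κ →L[𝕜] L2 𝕜 :=
  LinearMap.mkContinuous ((H1 𝕜).subtype ∘ₗ H10.toH1 𝕜 κ) (2 * (√κ)⁻¹) (norm_toH1_le κ)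

theorem inclL2_apply (w : H10 𝕜 κ) : inclL2 κ w = H10.toH1 𝕜 κ w := rfl

/-- The derivative `H¹₀(I) → L²(I)` as a bounded operator. -/
noncomputable def derivL2 : H10 𝕜 κ →L[𝕜] L2 𝕜 :=
  LinearMap.mkContinuous (weakDeriv 𝕜 ∘ₗ H10.toH1 𝕜 κ) (√κ)⁻¹ fun w => (norm_weakDeriv_H10 κ w).le

theorem derivL2_apply (w : H10 𝕜 κ) : derivL2 κ w = weakDeriv 𝕜 (H10.toH1 𝕜 κ w) := rfl

instance completeSpace_H10 : CompleteSpace (H10 𝕜 κ) := by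
  refine Metric.complete_of_cauchySeq_tendsto fun u hu => ?_
  obtain ⟨a, ha⟩ := cauchySeq_tendsto_of_complete
    ((inclL2 (𝕜 := 𝕜) κ).uniformContinuous.comp_cauchySeq hu)
  obtain ⟨b, hb⟩ := cauchySeq_tendsto_of_complete
    ((derivL2 (𝕜 := 𝕜) κ).uniformContinuous.comp_cauchySeq hu)
  have hcl : (a, b) ∈ (testPairs 𝕜).topologicalClosure :=
    isClosed_closure.mem_of_tendsto (ha.prodMk_nhds hb)
      (Eventually.of_forall fun n => mem_closure_testPairs κ (u n))
  obtain ⟨w, -, hw⟩ := exists_H10_of_mem_closure κ hcl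
  refine ⟨w, tendsto_iff_norm_sub_tendsto_zero.2 ?_⟩
  have := (tendsto_iff_norm_sub_tendsto_zero.1 hb).const_mul √κ
  rw [mul_zero] at this
  refine this.congr fun n => ?_
  rw [norm_H10, map_sub, map_sub, hw]
  rfl

end H10

/-! ### Smooth functions vanishing at the end points -/

section Cutoff

/-- Bounded convergence in the norm of `L²(I)`, for sequences that are eventually constant at each
point of `I`, as they arise from cutoffs. -/
theorem tendsto_toL2_of_dominated {g : ℕ → ℝ → 𝕜} {f : ℝ → 𝕜} (hg : ∀ k, Continuous (g k))
    (hf : Continuous f) {C : ℝ} (hC : ∀ k, ∀ x ∈ Ioo (-1 : ℝ) 1, ‖g k x - f x‖ ≤ C)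
    (hlim : ∀ x ∈ Ioo (-1 : ℝ) 1, ∀ᶠ k in atTop, g k x = f x) :
    Tendsto (fun k => toL2 (g k) (hg k)) atTop (𝓝 (toL2 f hf)) := by
  rw [tendsto_iff_norm_sub_tendsto_zero]
  have hsq : ∀ k, ‖toL2 (g k) (hg k) - toL2 f hf‖ ^ 2 =
      ∫ x in Ioo (-1 : ℝ) 1, ‖g k x - f x‖ ^ 2 := fun k => by
    rw [← toL2_sub, norm_toL2_sq]
    rfl
  have h0 : Tendsto (fun k => ∫ x in Ioo (-1 : ℝ) 1, ‖g k x - f x‖ ^ 2) atTop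
      (𝓝 (∫ x in Ioo (-1 : ℝ) 1, (0 : ℝ))) := by
    refine tendsto_integral_of_dominated_convergence (fun _ => C ^ 2)
      (fun k => (((hg k).sub hf).norm.pow 2).aestronglyMeasurable) (integrable_const _)
      (fun k => ?_) ?_
    · filter_upwards [ae_restrict_mem measurableSet_Ioo] with x hx
      rw [Real.norm_of_nonneg (by positivity)]
      gcongr
      exact hC k x hx
    · filter_upwards [ae_restrict_mem measurableSet_Ioo] with x hx
      refine tendsto_const_nhds.congr' ?_
      filter_upwards [hlim x hx] with k hk
      simp [hk]
  rw [integral_zero] at h0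
  simp only [← hsq] at h0
  simpa [Real.sqrt_sq] using h0.sqrt

/-- A smooth step from `0` to `1` between the points `1` and `2`. -/
theorem exists_cutoff : ∃ χ : ℝ → ℝ, ContDiff ℝ ∞ χ ∧ (∀ y, 0 ≤ χ y ∧ χ y ≤ 1) ∧
    (∀ y, y ≤ 1 → χ y = 0) ∧ (∀ y, 2 ≤ y → χ y = 1) := by
  refine ⟨fun y => Real.smoothTransition (y - 1),
    Real.smoothTransition.contDiff.comp (contDiff_id.sub contDiff_const),
    fun y => ⟨Real.smoothTransition.nonneg _, Real.smoothTransition.le_one _⟩,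
    fun y hy => Real.smoothTransition.zero_of_nonpos (by linarith),
    fun y hy => Real.smoothTransition.one_of_one_le (by linarith)⟩

/-- A smooth function that vanishes at the end points vanishes there at least linearly. -/
theorem exists_norm_le_mul_one_sub_sq {f f' : ℝ → 𝕜} (hf : ∀ x, HasDerivAt f (f' x) x)
    (hc' : Continuous f') (h1 : f 1 = 0) (h2 : f (-1) = 0) :
    ∃ C : ℝ, 0 ≤ C ∧ ∀ x ∈ Ioo (-1 : ℝ) 1, ‖f x‖ ≤ C * (1 - x ^ 2) ∧ ‖f' x‖ ≤ C := by
  obtain ⟨C, hC⟩ := isCompact_Icc.exists_bound_of_continuousOn (s := Icc (-1 : ℝ) 1)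
    hc'.continuousOn
  have hC0 : 0 ≤ C := (norm_nonneg _).trans (hC 0 (by simp))
  have hmv : ∀ x ∈ Icc (-1 : ℝ) 1, ∀ y ∈ Icc (-1 : ℝ) 1, ‖f y - f x‖ ≤ C * ‖y - x‖ :=
    fun x hx y hy => (convex_Icc (-1 : ℝ) 1).norm_image_sub_le_of_norm_hasDerivWithin_le
      (fun z _ => (hf z).hasDerivWithinAt) hC hx hy
  refine ⟨C, hC0, fun x hx => ⟨?_, hC x (Ioo_subset_Icc_self hx)⟩⟩
  have hx' := Ioo_subset_Icc_self hx
  rcases le_total 0 x with h | h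
  · have h3 := hmv 1 (by simp) x hx'
    rw [h1, sub_zero, Real.norm_eq_abs, abs_sub_comm, abs_of_pos (by linarith [hx.2])] at h3
    refine h3.trans (mul_le_mul_of_nonneg_left ?_ hC0)
    nlinarith [hx.2]
  · have h3 := hmv (-1) (by simp) x hx'
    rw [h2, sub_zero, Real.norm_eq_abs, abs_of_pos (by linarith [hx.1])] at h3
    refine h3.trans (mul_le_mul_of_nonneg_left ?_ hC0)
    nlinarith [hx.1]

/-- A smooth function that vanishes at the end points of `I` belongs to `H¹₀(I)`. It is the limit of
the test functions `χ (k (1 - x²)) f`: their derivatives stay bounded because `f` compensates for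
the growth of the derivative of the cutoff. -/
theorem toL2_mem_closure_testPairs {f f' : ℝ → 𝕜} (hs : ContDiff ℝ ∞ f)
    (hf : ∀ x, HasDerivAt f (f' x) x) (hc' : Continuous f') (h1 : f 1 = 0) (h2 : f (-1) = 0) :
    (toL2 f hs.continuous, toL2 f' hc') ∈ (testPairs 𝕜).topologicalClosure := by
  obtain ⟨χ, hχ, hχ01, hχ0, hχ1⟩ := exists_cutoff
  obtain ⟨C, hC0, hC⟩ := exists_norm_le_mul_one_sub_sq hf hc' h1 h2
  have hχd : Differentiable ℝ χ := hχ.differentiable (by simp)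
  have hχ'c : Continuous (deriv χ) := hχ.continuous_deriv (by simp)
  obtain ⟨K, hK⟩ := isCompact_Icc.exists_bound_of_continuousOn (s := Icc (0 : ℝ) 2)
    hχ'c.continuousOn
  have hK0 : 0 ≤ K := (norm_nonneg _).trans (hK 0 (by simp))
  have hχ'0 : ∀ y, 2 < y → deriv χ y = 0 := by
    intro y hy
    have : χ =ᶠ[𝓝 y] fun _ => 1 := by
      filter_upwards [lt_mem_nhds hy] with z hz using hχ1 z hz.le
    rw [this.deriv_eq, deriv_const]
  -- the cutoff functions and their derivatives
  set η : ℕ → ℝ → ℝ := fun k x => χ (k * (1 - x ^ 2)) with hη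
  set η' : ℕ → ℝ → ℝ := fun k x => deriv χ (k * (1 - x ^ 2)) * (k * (-(2 * x))) with hη'
  have hηd : ∀ k x, HasDerivAt (η k) (η' k x) x := by
    intro k x
    have hin : HasDerivAt (fun x : ℝ => (k : ℝ) * (1 - x ^ 2)) (k * (-(2 * x))) x := by
      have := ((hasDerivAt_pow 2 x).const_sub 1).const_mul (k : ℝ)
      simpa using this
    exact (hχd _).hasDerivAt.comp x hin
  have hηs : ∀ k, ContDiff ℝ ∞ (η k) := fun k => hχ.comp (by fun_prop)
  have hη'c : ∀ k, Continuous (η' k) := fun k =>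
    (hχ'c.comp (by fun_prop)).mul (by fun_prop)
  set φ : ℕ → ℝ → 𝕜 := fun k x => η k x • f x with hφ
  set φ' : ℕ → ℝ → 𝕜 := fun k x => η k x • f' x + η' k x • f x with hφ'
  have hφd : ∀ k x, HasDerivAt (φ k) (φ' k x) x := fun k x => (hηd k x).smul (hf x)
  have hφs : ∀ k, ContDiff ℝ ∞ (φ k) := fun k => (hηs k).smul hs
  have hφ'c : ∀ k, Continuous (φ' k) := fun k =>
    ((hηs k).continuous.smul hc').add ((hη'c k).smul hs.continuous)
  have htest : ∀ k, IsTestFunction (φ k) := by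
    intro k
    have hcl : IsClosed {x : ℝ | 1 ≤ (k : ℝ) * (1 - x ^ 2)} :=
      isClosed_le continuous_const (by fun_prop)
    have hsub : tsupport (φ k) ⊆ {x : ℝ | 1 ≤ (k : ℝ) * (1 - x ^ 2)} := by
      refine closure_minimal (fun x hx => ?_) hcl
      by_contra hlt
      exact hx (by simp [hφ, hη, hχ0 _ (not_le.1 hlt).le])
    have hIoo : tsupport (φ k) ⊆ Ioo (-1 : ℝ) 1 := by
      intro x hx
      have h3 : (1 : ℝ) ≤ k * (1 - x ^ 2) := hsub hx
      have h4 : 0 < 1 - x ^ 2 := by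
        by_contra hneg
        nlinarith [(Nat.cast_nonneg k : (0 : ℝ) ≤ k)]
      exact ⟨by nlinarith, by nlinarith⟩
    exact ⟨hφs k, isCompact_Icc.of_isClosed_subset (isClosed_tsupport _)
      (hIoo.trans Ioo_subset_Icc_self), hIoo⟩
  have hpos : ∀ x ∈ Ioo (-1 : ℝ) 1, 0 < 1 - x ^ 2 := fun x hx => by nlinarith [hx.1, hx.2]
  have hlarge : ∀ x ∈ Ioo (-1 : ℝ) 1, ∀ᶠ k : ℕ in atTop, 2 < (k : ℝ) * (1 - x ^ 2) := fun x hx =>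
    (tendsto_natCast_atTop_atTop.atTop_mul_const (hpos x hx)).eventually_gt_atTop 2
  have hη1 : ∀ k x, ‖η k x - 1‖ ≤ 1 := fun k x => by
    rw [Real.norm_eq_abs, abs_le]
    have := hχ01 (k * (1 - x ^ 2))
    exact ⟨by simp only [hη]; linarith, by simp only [hη]; linarith⟩
  have hlim1 : Tendsto (fun k => toL2 (φ k) (hφs k).continuous) atTop
      (𝓝 (toL2 f hs.continuous)) := by
    refine tendsto_toL2_of_dominated _ _ (C := C) (fun k x hx => ?_) fun x hx => ?_
    · have h3 : φ k x - f x = (η k x - 1) • f x := by simp [hφ, sub_smul]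
      rw [h3, norm_smul]
      have h4 := (hC x hx).1
      nlinarith [hη1 k x, norm_nonneg (f x), sq_nonneg x, norm_nonneg (η k x - 1)]
    · filter_upwards [hlarge x hx] with k hk
      simp [hφ, hη, hχ1 _ hk.le]
  have hlim2 : Tendsto (fun k => toL2 (φ' k) (hφ'c k)) atTop (𝓝 (toL2 f' hc')) := by
    refine tendsto_toL2_of_dominated _ _ (C := C + 4 * K * C) (fun k x hx => ?_) fun x hx => ?_
    · have h3 : φ' k x - f' x = (η k x - 1) • f' x + η' k x • f x := by
        simp only [hφ', sub_smul, one_smul]; abel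
      rw [h3]
      refine (norm_add_le _ _).trans (add_le_add ?_ ?_)
      · rw [norm_smul]
        have h4 := (hC x hx).2
        nlinarith [hη1 k x, norm_nonneg (f' x), norm_nonneg (η k x - 1)]
      · rw [norm_smul]
        have hk0 : (0 : ℝ) ≤ k := Nat.cast_nonneg k
        have hy0 : 0 ≤ (k : ℝ) * (1 - x ^ 2) := mul_nonneg hk0 (hpos x hx).le
        rcases lt_or_ge 2 ((k : ℝ) * (1 - x ^ 2)) with hy | hy
        · have : η' k x = 0 := by simp only [hη', hχ'0 _ hy, zero_mul]
          rw [this, norm_zero, zero_mul]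
          positivity
        · have h5 : ‖η' k x‖ ≤ K * (k * 2) := by
            simp only [hη']
            rw [norm_mul, norm_mul, norm_neg, norm_mul]
            have hx1 : ‖x‖ ≤ 1 := by rw [Real.norm_eq_abs, abs_le]; exact ⟨hx.1.le, hx.2.le⟩
            rw [Real.norm_of_nonneg hk0, Real.norm_two]
            gcongr
            · exact hK _ ⟨hy0, hy⟩
            · linarith
          calc ‖η' k x‖ * ‖f x‖ ≤ K * (k * 2) * (C * (1 - x ^ 2)) := by
                gcongr; exact (hC x hx).1
            _ = 2 * K * C * (k * (1 - x ^ 2)) := by ring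
            _ ≤ 2 * K * C * 2 := by gcongr
            _ = 4 * K * C := by ring
    · filter_upwards [hlarge x hx] with k hk
      simp only [hφ', hη, hη', hχ1 _ hk.le, hχ'0 _ hk, zero_mul, one_smul, zero_smul, add_zero]
  refine mem_closure_of_tendsto (hlim1.prodMk_nhds hlim2) (Eventually.of_forall fun k => ?_)
  have hd : deriv (φ k) = φ' k := funext fun x => (hφd k x).deriv
  refine ⟨φ k, htest k, coeFn_toL2 (hφs k).continuous, ?_⟩
  rw [hd]
  exact coeFn_toL2 (hφ'c k)

end Cutoff
end Sobolev

/-! ### The Dirichlet eigenfunctions -/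

section Sines
variable {𝕜 : Type*} [RCLike 𝕜]

/-- The frequency `n π / 2` of the `n`-th Dirichlet eigenfunction of `I`. -/
noncomputable def freq (n : ℕ) : ℝ := n * Real.pi / 2

theorem freq_pos {n : ℕ} (hn : 1 ≤ n) : 0 < freq n := by
  have : (0 : ℝ) < n := by exact_mod_cast hn
  unfold freq
  positivity

theorem freq_injective : Function.Injective freq := by
  intro n m h
  have hπ := Real.pi_pos
  unfold freq at h
  have : (n : ℝ) = m := by
    field_simp at h
    exact h
  exact_mod_cast this

theorem sin_freq_mul_two (n : ℕ) : Real.sin (freq n * 2) = 0 := by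
  have : freq n * 2 = n * Real.pi := by unfold freq; ring
  rw [this, Real.sin_nat_mul_pi]

/-- The Dirichlet eigenfunction `sin (n π (x + 1) / 2)`. -/
noncomputable def sineFun (𝕜 : Type*) [RCLike 𝕜] (n : ℕ) (x : ℝ) : 𝕜 :=
  ((Real.sin (freq n * (x + 1)) : ℝ) : 𝕜)

/-- The derivative of the Dirichlet eigenfunction `sineFun`. -/
noncomputable def sineFunDeriv (𝕜 : Type*) [RCLike 𝕜] (n : ℕ) (x : ℝ) : 𝕜 :=
  ((Real.cos (freq n * (x + 1)) * freq n : ℝ) : 𝕜)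

theorem hasDerivAt_ofReal {f : ℝ → ℝ} {f' x : ℝ} (h : HasDerivAt f f' x) :
    HasDerivAt (fun x => ((f x : ℝ) : 𝕜)) (f' : 𝕜) x :=
  (RCLike.ofRealCLM (K := 𝕜)).hasFDerivAt.comp_hasDerivAt x h

theorem hasDerivAt_freq_mul (n : ℕ) (x : ℝ) :
    HasDerivAt (fun x => freq n * (x + 1)) (freq n) x := by
  simpa using ((hasDerivAt_id x).add_const (1 : ℝ)).const_mul (freq n)

theorem hasDerivAt_sineFun (n : ℕ) (x : ℝ) : HasDerivAt (sineFun 𝕜 n) (sineFunDeriv 𝕜 n x) x :=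
  hasDerivAt_ofReal (hasDerivAt_freq_mul n x).sin

theorem hasDerivAt_sineFunDeriv (n : ℕ) (x : ℝ) :
    HasDerivAt (sineFunDeriv 𝕜 n) (((-(freq n ^ 2) : ℝ) : 𝕜) * sineFun 𝕜 n x) x := by
  have h := hasDerivAt_ofReal (𝕜 := 𝕜) ((hasDerivAt_freq_mul n x).cos.mul_const (freq n))
  convert! h using 1
  rw [sineFun, ← RCLike.ofReal_mul]
  congr 1
  ring

theorem contDiff_sineFun (n : ℕ) : ContDiff ℝ ∞ (sineFun 𝕜 n) :=
  (RCLike.ofRealCLM (K := 𝕜)).contDiff.comp (Real.contDiff_sin.comp (by fun_prop))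

theorem continuous_sineFunDeriv (n : ℕ) : Continuous (sineFunDeriv 𝕜 n) :=
  RCLike.continuous_ofReal.comp (by fun_prop)

/-- The Dirichlet eigenfunction `sin (n π (x + 1) / 2)` as an element of `L²(I)`. -/
noncomputable def sine (𝕜 : Type*) [RCLike 𝕜] (n : ℕ) : L2 𝕜 :=
  toL2 (sineFun 𝕜 n) (contDiff_sineFun n).continuous

/-- The derivative of the Dirichlet eigenfunction `sine`. -/
noncomputable def sineDeriv (𝕜 : Type*) [RCLike 𝕜] (n : ℕ) : L2 𝕜 :=
  toL2 (sineFunDeriv 𝕜 n) (continuous_sineFunDeriv n)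

theorem hasWeakDeriv_sineDeriv (n : ℕ) :
    HasWeakDeriv (sineDeriv 𝕜 n) (((-(freq n ^ 2) : ℝ) : 𝕜) • sine 𝕜 n) :=
  hasWeakDeriv_toL2 (hasDerivAt_sineFunDeriv n) (continuous_sineFunDeriv n)
    (continuous_const.mul (contDiff_sineFun n).continuous)

theorem sine_mem_closure (n : ℕ) :
    (sine 𝕜 n, sineDeriv 𝕜 n) ∈ (testPairs 𝕜).topologicalClosure := by
  refine toL2_mem_closure_testPairs (contDiff_sineFun n) (hasDerivAt_sineFun n) _ ?_ ?_
  · rw [sineFun, one_add_one_eq_two, sin_freq_mul_two, RCLike.ofReal_zero]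
  · simp [sineFun]

theorem norm_sine {n : ℕ} (hn : 1 ≤ n) : ‖sine 𝕜 n‖ = 1 := by
  have h0 := (freq_pos hn).ne'
  have hd : ∀ x : ℝ, HasDerivAt (fun x => x / 2 -
      Real.sin (freq n * (x + 1)) * Real.cos (freq n * (x + 1)) / (2 * freq n))
      (Real.sin (freq n * (x + 1)) ^ 2) x := by
    intro x
    have h := ((hasDerivAt_id x).div_const 2).sub
      (((hasDerivAt_freq_mul n x).sin.mul (hasDerivAt_freq_mul n x).cos).div_const (2 * freq n))
    convert! h using 1
    field_simp
    linear_combination (Real.sin_sq_add_cos_sq (freq n * (x + 1)))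
  have h1 : ‖sine 𝕜 n‖ ^ 2 = 1 := by
    rw [sine, norm_toL2_sq, ← integral_Ioc_eq_integral_Ioo,
      ← intervalIntegral.integral_of_le (by norm_num)]
    simp only [sineFun, RCLike.norm_ofReal, sq_abs]
    rw [intervalIntegral.integral_eq_sub_of_hasDerivAt (fun x _ => hd x)
      ((by fun_prop : Continuous fun x => Real.sin (freq n * (x + 1)) ^ 2).intervalIntegrable _ _),
      one_add_one_eq_two, sin_freq_mul_two]
    norm_num
  nlinarith [norm_nonneg (sine 𝕜 n)]

section Completeness
variable {f : L2 𝕜}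

theorem integrable_mul_ofReal (f : L2 𝕜) {g : ℝ → ℝ} (hg : Continuous g) :
    Integrable (fun x => f x * ((g x : ℝ) : 𝕜)) (volume.restrict (Ioo (-1 : ℝ) 1)) :=
  MemLp.integrable_mul (Lp.memLp f) (memLp_of_continuous (RCLike.continuous_ofReal.comp hg))

/-- A function orthogonal to all sines is orthogonal to all `cos^k θ sin (n θ)`. -/
theorem integral_cos_pow_mul_sin_eq_zero (hf : ∀ n, 1 ≤ n → inner 𝕜 (sine 𝕜 n) f = 0) (k n : ℕ) :
    ∫ x in Ioo (-1 : ℝ) 1,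
      f x * ((Real.cos (freq 1 * (x + 1)) ^ k * Real.sin (freq n * (x + 1)) : ℝ) : 𝕜) = 0 := by
  induction k generalizing n with
  | zero =>
    rcases Nat.eq_zero_or_pos n with rfl | hn
    · simp [freq]
    · have h := hf n hn
      rw [sine, inner_eq_integral_of_ae (coeFn_toL2 _)] at h
      simpa [sineFun] using h
  | succ k ih =>
    rcases n with _ | n
    · simp [freq]
    · have h := fun m => integrable_mul_ofReal f
        (by fun_prop : Continuous fun x =>
          Real.cos (freq 1 * (x + 1)) ^ k * Real.sin (freq m * (x + 1)))
      have hsum := integral_add (h (n + 2)) (h n)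
      rw [ih, ih, add_zero] at hsum
      rw [← mul_eq_zero_iff_left (two_ne_zero (α := 𝕜)), ← integral_const_mul, ← hsum]
      refine integral_congr_ae (Eventually.of_forall fun x => ?_)
      have e1 : freq (n + 2) * (x + 1) = freq (n + 1) * (x + 1) + freq 1 * (x + 1) := by
        simp only [freq]; push_cast; ring
      have e2 : freq n * (x + 1) = freq (n + 1) * (x + 1) - freq 1 * (x + 1) := by
        simp only [freq]; push_cast; ring
      simp only
      rw [e1, e2, Real.sin_add, Real.sin_sub]
      push_cast
      ring

theorem integral_polynomial_mul_sin_eq_zero (hf : ∀ n, 1 ≤ n → inner 𝕜 (sine 𝕜 n) f = 0)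
    (p : Polynomial ℝ) :
    ∫ x in Ioo (-1 : ℝ) 1,
      f x * ((p.eval (Real.cos (freq 1 * (x + 1))) * Real.sin (freq 1 * (x + 1)) : ℝ) : 𝕜) = 0 := by
  induction p using Polynomial.induction_on' with
  | add p q hp hq =>
    have h := fun p : Polynomial ℝ => integrable_mul_ofReal f
        (by fun_prop : Continuous fun x =>
          p.eval (Real.cos (freq 1 * (x + 1))) * Real.sin (freq 1 * (x + 1)))
    have hsum := integral_add (h p) (h q)
    rw [hp, hq, add_zero] at hsum
    rw [← hsum]
    refine integral_congr_ae (Eventually.of_forall fun x => ?_)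
    simp only [Polynomial.eval_add]
    push_cast
    ring
  | monomial k a =>
    have h := integral_cos_pow_mul_sin_eq_zero hf k 1
    rw [← mul_eq_zero_of_right (a : 𝕜) h, ← integral_const_mul]
    refine integral_congr_ae (Eventually.of_forall fun x => ?_)
    simp only [Polynomial.eval_monomial]
    push_cast
    ring

/-- Every continuous function on `I` is a uniform limit of polynomials in `cos θ`, where
`θ = π (x + 1) / 2` runs through `(0, π)`. -/
theorem integral_continuous_mul_sin_eq_zero (hf : ∀ n, 1 ≤ n → inner 𝕜 (sine 𝕜 n) f = 0)
    {ψ : ℝ → ℝ} (hψ : Continuous ψ) :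
    ∫ x in Ioo (-1 : ℝ) 1, f x * ((ψ x * Real.sin (freq 1 * (x + 1)) : ℝ) : 𝕜) = 0 := by
  rw [← norm_le_zero_iff]
  set I := ∫ x in Ioo (-1 : ℝ) 1, ‖f x‖ with hI
  have hfi : Integrable (fun x => ‖f x‖) (volume.restrict (Ioo (-1 : ℝ) 1)) :=
    ((Lp.memLp f).integrable (by norm_num)).norm
  have hI0 : 0 ≤ I := integral_nonneg fun x => norm_nonneg _
  refine le_of_forall_pos_le_add fun δ hδ => ?_
  set ε := δ / (I + 1) with hε
  have hε0 : 0 < ε := by positivity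
  have hc : Continuous fun c : ℝ => ψ (2 * Real.arccos c / Real.pi - 1) := by fun_prop
  obtain ⟨p, hp⟩ := exists_polynomial_near_of_continuousOn (-1) 1 _ hc.continuousOn ε hε0
  have h1 := integrable_mul_ofReal f
    (by fun_prop : Continuous fun x => ψ x * Real.sin (freq 1 * (x + 1)))
  have h2 := integrable_mul_ofReal f
    (by fun_prop : Continuous fun x =>
      p.eval (Real.cos (freq 1 * (x + 1))) * Real.sin (freq 1 * (x + 1)))
  have h3 := integral_sub h1 h2
  rw [integral_polynomial_mul_sin_eq_zero hf p, sub_zero] at h3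
  rw [← h3, zero_add]
  calc _ ≤ ∫ x in Ioo (-1 : ℝ) 1, ‖f x‖ * ε := by
        refine norm_integral_le_of_norm_le (hfi.mul_const ε) ?_
        filter_upwards [ae_restrict_mem measurableSet_Ioo] with x hx
        have hθ : freq 1 * (x + 1) = Real.pi * (x + 1) / 2 := by simp only [freq]; push_cast; ring
        have harc : 2 * Real.arccos (Real.cos (freq 1 * (x + 1))) / Real.pi - 1 = x := by
          rw [Real.arccos_cos, hθ]
          · field_simp
            ring
          · rw [hθ]
            have := hx.1
            have : 0 ≤ x + 1 := by linarith
            positivity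
          · rw [hθ]
            nlinarith [hx.2, Real.pi_pos]
        have h4 := hp (Real.cos (freq 1 * (x + 1))) ⟨Real.neg_one_le_cos _, Real.cos_le_one _⟩
        rw [harc] at h4
        rw [← mul_sub, ← RCLike.ofReal_sub, ← sub_mul, norm_mul, RCLike.norm_ofReal, abs_mul,
          abs_sub_comm]
        gcongr
        calc _ ≤ ε * 1 := by
              gcongr
              exact Real.abs_sin_le_one _
          _ = ε := mul_one _
    _ = I * ε := by rw [integral_mul_const]
    _ ≤ δ := by
        rw [hε, mul_div_assoc', div_le_iff₀ (by positivity)]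
        nlinarith

/-- The sines are complete in `L²(I)`. -/
theorem eq_zero_of_inner_sine_eq_zero (hf : ∀ n, 1 ≤ n → inner 𝕜 (sine 𝕜 n) f = 0) : f = 0 := by
  have hint := integrable_mul_ofReal f
    (by fun_prop : Continuous fun x => Real.sin (freq 1 * (x + 1)))
  have hloc : LocallyIntegrableOn (fun x => f x * ((Real.sin (freq 1 * (x + 1)) : ℝ) : 𝕜))
      (Ioo (-1 : ℝ) 1) volume := IntegrableOn.locallyIntegrableOn hint
  have key := isOpen_Ioo.ae_eq_zero_of_integral_contDiff_smul_eq_zero hloc (by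
    intro ψ hψ hc hs
    rw [← integral_continuous_mul_sin_eq_zero hf hψ.continuous,
      ← setIntegral_eq_integral_of_forall_compl_eq_zero (s := Ioo (-1 : ℝ) 1)]
    · refine integral_congr_ae (Eventually.of_forall fun x => ?_)
      simp only [RCLike.real_smul_eq_coe_mul]
      push_cast
      ring
    · intro x hx
      have : ψ x = 0 := by
        by_contra hne
        exact hx (hs (subset_tsupport ψ hne))
      simp [this])
  rw [Lp.eq_zero_iff_ae_eq_zero]
  refine (ae_restrict_iff' measurableSet_Ioo).2 ?_
  filter_upwards [key] with x hx hxI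
  refine (mul_eq_zero.1 (hx hxI)).resolve_right (RCLike.ofReal_ne_zero.2 ?_)
  have hθ : freq 1 * (x + 1) = Real.pi * (x + 1) / 2 := by simp only [freq]; push_cast; ring
  refine (Real.sin_pos_of_pos_of_lt_pi ?_ ?_).ne'
  · exact mul_pos (freq_pos le_rfl) (by linarith [hxI.1])
  · rw [hθ]
    nlinarith [hxI.2, Real.pi_pos]

end Completeness

section SineH10
variable (κ : ℝ) [hκ : Fact (0 < κ)]

/-- The Dirichlet eigenfunction `sin (n π (x + 1) / 2)` as an element of `H¹₀(I)`. -/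
noncomputable def sineH10 (𝕜 : Type*) [RCLike 𝕜] (κ : ℝ) (n : ℕ) : H10 𝕜 κ :=
  (exists_H10_of_mem_closure κ (sine_mem_closure (𝕜 := 𝕜) n)).choose

omit hκ in
theorem toH1_sineH10 (n : ℕ) : (H10.toH1 𝕜 κ (sineH10 𝕜 κ n) : L2 𝕜) = sine 𝕜 n :=
  (exists_H10_of_mem_closure κ (sine_mem_closure (𝕜 := 𝕜) n)).choose_spec.1

omit hκ in
theorem weakDeriv_sineH10 (n : ℕ) : weakDeriv 𝕜 (H10.toH1 𝕜 κ (sineH10 𝕜 κ n)) = sineDeriv 𝕜 n :=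
  (exists_H10_of_mem_closure κ (sine_mem_closure (𝕜 := 𝕜) n)).choose_spec.2

/-- The eigenvalue equation in weak form. -/
theorem inner_sineH10 (n : ℕ) (w : H10 𝕜 κ) :
    inner 𝕜 (sineH10 𝕜 κ n) w =
      ((κ * freq n ^ 2 : ℝ) : 𝕜) * inner 𝕜 (sine 𝕜 n) (H10.toH1 𝕜 κ w : L2 𝕜) := by
  have h := inner_weakDeriv_H10 κ (hasWeakDeriv_sineDeriv (𝕜 := 𝕜) n) w
  rw [H10.inner_def, weakDeriv_sineH10, ← inner_conj_symm, h, inner_smul_right, map_neg, map_mul,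
    inner_conj_symm, RCLike.conj_ofReal]
  push_cast
  ring

omit hκ in
theorem inner_sine_of_ne {n m : ℕ} (h : n ≠ m) : inner 𝕜 (sine 𝕜 n) (sine 𝕜 m) = 0 := by
  have : Fact ((0 : ℝ) < 1) := ⟨one_pos⟩
  have h1 := inner_sineH10 (𝕜 := 𝕜) 1 n (sineH10 𝕜 1 m)
  have h2 := inner_sineH10 (𝕜 := 𝕜) 1 m (sineH10 𝕜 1 n)
  rw [toH1_sineH10, one_mul] at h1 h2
  rw [← inner_conj_symm, h2, map_mul, inner_conj_symm, RCLike.conj_ofReal] at h1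
  by_contra hne
  have h3 := mul_right_cancel₀ hne h1
  have h4 : freq m ^ 2 = freq n ^ 2 := by exact_mod_cast h3
  have hf : ∀ k, 0 ≤ freq k := fun k => by have := Real.pi_pos; unfold freq; positivity
  exact h (freq_injective ((sq_eq_sq₀ (hf m) (hf n)).1 h4)).symm

end SineH10
end Sines

/-! ### Diagonalization of the damped-wave operator -/

section Modes
variable {𝕜 : Type*} [RCLike 𝕜] (κ : ℝ)

/-- The undamped angular frequency `√κ n π / 2` of the `n`-th mode, for indices shifted to start
at `0`. -/
noncomputable def waveFreq (n : ℕ) : ℝ := √κ * freq (n + 1)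

theorem waveFreq_sq (hκ : 0 < κ) (n : ℕ) : waveFreq κ n ^ 2 = κ * freq (n + 1) ^ 2 := by
  rw [waveFreq, mul_pow, Real.sq_sqrt hκ.le]

theorem waveFreq_pos (hκ : 0 < κ) (n : ℕ) : 0 < waveFreq κ n :=
  mul_pos (Real.sqrt_pos.2 hκ) (freq_pos (Nat.succ_pos n))

theorem ofReal_waveFreq_ne_zero (hκ : 0 < κ) (n : ℕ) : (waveFreq κ n : 𝕜) ≠ 0 :=
  RCLike.ofReal_ne_zero.2 (waveFreq_pos κ hκ n).ne'

theorem waveFreq_zero_le (n : ℕ) : waveFreq κ 0 ≤ waveFreq κ n := by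
  unfold waveFreq freq
  have := Real.pi_pos
  gcongr
  omega

theorem tendsto_waveFreq (hκ : 0 < κ) : Tendsto (waveFreq κ) atTop atTop := by
  refine Tendsto.const_mul_atTop (Real.sqrt_pos.2 hκ) ?_
  have h := ((tendsto_natCast_atTop_atTop (R := ℝ)).comp (tendsto_add_atTop_nat 1)).atTop_mul_const
    (half_pos Real.pi_pos)
  refine h.congr fun n => ?_
  simp only [freq, Function.comp_apply]
  ring

/-- The normalized Dirichlet eigenfunctions of `H¹₀(I)`. -/
noncomputable def modeH10 (𝕜 : Type*) [RCLike 𝕜] (κ : ℝ) (n : ℕ) : H10 𝕜 κ :=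
  ((waveFreq κ n : 𝕜))⁻¹ • sineH10 𝕜 κ (n + 1)

variable [hκ : Fact (0 < κ)]

theorem inner_modeH10 (n : ℕ) (w : H10 𝕜 κ) :
    inner 𝕜 (modeH10 𝕜 κ n) w =
      (waveFreq κ n : 𝕜) * inner 𝕜 (sine 𝕜 (n + 1)) (H10.toH1 𝕜 κ w : L2 𝕜) := by
  have h0 : (waveFreq κ n : 𝕜) ≠ 0 := ofReal_waveFreq_ne_zero κ hκ.out n
  rw [modeH10, inner_smul_left, inner_sineH10, ← waveFreq_sq κ hκ.out, map_inv₀,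
    RCLike.conj_ofReal, ← mul_assoc]
  congr 1
  push_cast
  field_simp

theorem waveFreq_mul_inner_modeH10 (n : ℕ) (w : H10 𝕜 κ) :
    (waveFreq κ n : 𝕜) * inner 𝕜 (modeH10 𝕜 κ n) w =
      (κ : 𝕜) * inner 𝕜 (sineDeriv 𝕜 (n + 1)) (weakDeriv 𝕜 (H10.toH1 𝕜 κ w)) := by
  have h0 : (waveFreq κ n : 𝕜) ≠ 0 := ofReal_waveFreq_ne_zero κ hκ.out n
  rw [modeH10, inner_smul_left, map_inv₀, RCLike.conj_ofReal, mul_inv_cancel_left₀ h0,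
    H10.inner_def, weakDeriv_sineH10]

omit hκ in
theorem toH1_modeH10 (n : ℕ) : (H10.toH1 𝕜 κ (modeH10 𝕜 κ n) : L2 𝕜) =
    ((waveFreq κ n : 𝕜))⁻¹ • sine 𝕜 (n + 1) := by
  rw [modeH10, map_smul, Submodule.coe_smul, toH1_sineH10]

theorem orthonormal_modeH10 : Orthonormal 𝕜 (modeH10 𝕜 κ) := by
  have h0 : ∀ n, (waveFreq κ n : 𝕜) ≠ 0 := ofReal_waveFreq_ne_zero κ hκ.out
  refine ⟨fun n => ?_, fun n m h => ?_⟩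
  · have h1 : inner 𝕜 (modeH10 𝕜 κ n) (modeH10 𝕜 κ n) = 1 := by
      rw [inner_modeH10, toH1_modeH10, inner_smul_right, mul_inv_cancel_left₀ (h0 n),
        inner_self_eq_norm_sq_to_K, norm_sine (Nat.succ_pos n)]
      simp
    rw [inner_self_eq_norm_sq_to_K] at h1
    have h2 : ‖modeH10 𝕜 κ n‖ ^ 2 = 1 := by exact_mod_cast h1
    nlinarith [norm_nonneg (modeH10 𝕜 κ n)]
  · change inner 𝕜 (modeH10 𝕜 κ n) (modeH10 𝕜 κ m) = 0
    rw [inner_modeH10, toH1_modeH10, inner_smul_right, inner_sine_of_ne (by simpa using h),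
      mul_zero, mul_zero]

/-- The embedding of the `n`-th mode: `(p, q)` stands for `p` times the normalized eigenfunction in
the first component and `q` times the eigenfunction in the second one. -/
noncomputable def modeEmb (𝕜 : Type*) [RCLike 𝕜] (κ : ℝ) [Fact (0 < κ)] (n : ℕ) :
    WithLp 2 (𝕜 × 𝕜) →ₗᵢ[𝕜] Energy 𝕜 κ where
  toFun x := WithLp.toLp 2 (x.fst • modeH10 𝕜 κ n, x.snd • sine 𝕜 (n + 1))
  map_add' x y := by
    apply WithLp.ofLp_injective
    ext1 <;> simp [add_smul]
  map_smul' c x := by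
    apply WithLp.ofLp_injective
    ext1 <;> simp [mul_smul]
  norm_map' x := by
    rw [← sq_eq_sq₀ (norm_nonneg _) (norm_nonneg _), WithLp.prod_norm_sq_eq_of_L2,
      WithLp.prod_norm_sq_eq_of_L2]
    simp [norm_smul, (orthonormal_modeH10 (𝕜 := 𝕜) κ).1 n, norm_sine (Nat.succ_pos n)]

theorem modeEmb_apply (n : ℕ) (x : WithLp 2 (𝕜 × 𝕜)) :
    modeEmb 𝕜 κ n x = WithLp.toLp 2 (x.fst • modeH10 𝕜 κ n, x.snd • sine 𝕜 (n + 1)) := rfl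

theorem inner_modeEmb (n : ℕ) (x : WithLp 2 (𝕜 × 𝕜)) (f : Energy 𝕜 κ) :
    inner 𝕜 (modeEmb 𝕜 κ n x) f =
      inner 𝕜 x
        (WithLp.toLp 2 (inner 𝕜 (modeH10 𝕜 κ n) f.fst, inner 𝕜 (sine 𝕜 (n + 1)) f.snd)) := by
  rw [modeEmb_apply, WithLp.prod_inner_apply, WithLp.prod_inner_apply]
  simp [inner_smul_left, mul_comm]

theorem H10_eq_zero_of_inner_mode {w : H10 𝕜 κ} (h : ∀ n, inner 𝕜 (modeH10 𝕜 κ n) w = 0) :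
    w = 0 := by
  refine H10_ext κ (Eq.trans (eq_zero_of_inner_sine_eq_zero fun n hn => ?_)
    (by simp : (0 : L2 𝕜) = (H10.toH1 𝕜 κ 0 : L2 𝕜)))
  obtain ⟨n, rfl⟩ := Nat.exists_eq_succ_of_ne_zero (Nat.one_le_iff_ne_zero.1 hn)
  have h1 := h n
  rw [inner_modeH10] at h1
  exact (mul_eq_zero.1 h1).resolve_left (ofReal_waveFreq_ne_zero κ hκ.out n)

theorem isHilbertSum_modeEmb :
    IsHilbertSum 𝕜 (fun _ : ℕ => WithLp 2 (𝕜 × 𝕜)) (modeEmb 𝕜 κ) := by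
  refine IsHilbertSum.mk (fun n m h x y => ?_) ?_
  · rw [inner_modeEmb]
    change inner 𝕜 x (WithLp.toLp 2 (inner 𝕜 (modeH10 𝕜 κ n) (y.fst • modeH10 𝕜 κ m),
      inner 𝕜 (sine 𝕜 (n + 1)) (y.snd • sine 𝕜 (m + 1)))) = 0
    rw [inner_smul_right, inner_smul_right, (orthonormal_modeH10 (𝕜 := 𝕜) κ).2 h,
      inner_sine_of_ne (by simpa using h)]
    simp [WithLp.prod_inner_apply]
  · rw [top_le_iff, Submodule.topologicalClosure_eq_top_iff, Submodule.eq_bot_iff]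
    intro f hf
    have h0 : ∀ n x, inner 𝕜 (modeEmb 𝕜 κ n x) f = 0 := fun n x =>
      (Submodule.mem_orthogonal _ f).1 hf _
        (Submodule.mem_iSup_of_mem n (LinearMap.mem_range_self _ x))
    have h1 : f.fst = 0 := by
      refine H10_eq_zero_of_inner_mode κ fun n => ?_
      have := h0 n (WithLp.toLp 2 (1, 0))
      rw [inner_modeEmb, WithLp.prod_inner_apply] at this
      simpa using this
    have h2 : f.snd = 0 := by
      refine eq_zero_of_inner_sine_eq_zero fun n hn => ?_
      obtain ⟨n, rfl⟩ := Nat.exists_eq_succ_of_ne_zero (Nat.one_le_iff_ne_zero.1 hn)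
      have := h0 n (WithLp.toLp 2 (0, 1))
      rw [inner_modeEmb, WithLp.prod_inner_apply] at this
      simpa using this
    exact WithLp.ofLp_injective 2 (Prod.ext h1 h2)

/-- The decomposition of the energy space into modes. -/
noncomputable def modeDecomp (𝕜 : Type*) [RCLike 𝕜] (κ : ℝ) [Fact (0 < κ)] :
    Energy 𝕜 κ ≃ₗᵢ[𝕜] lp (fun _ : ℕ => WithLp 2 (𝕜 × 𝕜)) 2 :=
  (isHilbertSum_modeEmb κ).linearIsometryEquiv

theorem modeDecomp_apply (f : Energy 𝕜 κ) (n : ℕ) :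
    modeDecomp 𝕜 κ f n =
      WithLp.toLp 2 (inner 𝕜 (modeH10 𝕜 κ n) f.fst, inner 𝕜 (sine 𝕜 (n + 1)) f.snd) := by
  refine ext_inner_left 𝕜 fun x => ?_
  have h : modeDecomp 𝕜 κ (modeEmb 𝕜 κ n x) = lp.single 2 n x := by
    rw [← LinearIsometryEquiv.eq_symm_apply]
    exact ((isHilbertSum_modeEmb κ).linearIsometryEquiv_symm_apply_single x).symm
  rw [← inner_modeEmb, ← (modeDecomp 𝕜 κ).inner_map_map, h, lp.inner_single_left]

omit hκ in
theorem hasWeakDeriv_second (u : H2H10 𝕜 κ) :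
    HasWeakDeriv (weakDeriv 𝕜 (H10.toH1 𝕜 κ (H2H10.toH10 𝕜 κ u))) (H2H10.second 𝕜 κ u) :=
  weakDeriv_spec (⟨weakDeriv 𝕜 (H10.toH1 𝕜 κ (H2H10.toH10 𝕜 κ u)), u.2⟩ : H1 𝕜)

omit hκ in
theorem exists_H2H10_of_hasWeakDeriv {u : H10 𝕜 κ} {g : L2 𝕜}
    (h : HasWeakDeriv (weakDeriv 𝕜 (H10.toH1 𝕜 κ u)) g) :
    ∃ y : H2H10 𝕜 κ, H2H10.toH10 𝕜 κ y = u ∧ H2H10.second 𝕜 κ y = g := by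
  set y : H2H10 𝕜 κ := ⟨u, ⟨g, h⟩⟩ with hy
  have hu : H2H10.toH10 𝕜 κ y = u := rfl
  refine ⟨y, hu, (hasWeakDeriv_second κ y).unique ?_⟩
  rw [hu]
  exact h

omit hκ in
/-- The weak derivative may be tested with the eigenfunctions instead of test functions, because
they span a dense subspace of `H¹₀(I)`. -/
theorem hasWeakDeriv_of_inner_sine {u g : L2 𝕜}
    (h : ∀ n : ℕ, inner 𝕜 (sineDeriv 𝕜 (n + 1)) u = -inner 𝕜 (sine 𝕜 (n + 1)) g) :
    HasWeakDeriv u g := by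
  have : Fact ((0 : ℝ) < 1) := ⟨one_pos⟩
  -- By the Riesz representation theorem the defect is represented by some `r ∈ H¹₀(I)`.
  set r : H10 𝕜 1 := (derivL2 1).adjoint u + (inclL2 1).adjoint g with hr
  have hinner : ∀ w : H10 𝕜 1, inner 𝕜 w r = inner 𝕜 (weakDeriv 𝕜 (H10.toH1 𝕜 1 w)) u +
      inner 𝕜 (H10.toH1 𝕜 1 w : L2 𝕜) g := fun w => by
    rw [hr, inner_add_right, ContinuousLinearMap.adjoint_inner_right,
      ContinuousLinearMap.adjoint_inner_right, derivL2_apply, inclL2_apply]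
  have hr0 : r = 0 := by
    refine H10_eq_zero_of_inner_mode 1 fun n => ?_
    rw [modeH10, inner_smul_left, hinner, toH1_sineH10, weakDeriv_sineH10, h, neg_add_cancel,
      mul_zero]
  refine hasWeakDeriv_of_inner_H10 1 fun w => ?_
  have := hinner w
  rw [hr0, inner_zero_right] at this
  exact eq_neg_of_add_eq_zero_left this.symm

/-- The mode decomposition diagonalizes the damped-wave operator, including its domain. -/
theorem exists_waveAction_iff (ν : ℝ) (f g : Energy 𝕜 κ) :
    (∃ d, WaveDomain.incl 𝕜 κ d = f ∧ waveAction 𝕜 κ ν d = g) ↔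
      ∀ n, waveBlock (waveFreq κ n) ν (modeDecomp 𝕜 κ f n) = modeDecomp 𝕜 κ g n := by
  have hκ0 : (κ : 𝕜) ≠ 0 := RCLike.ofReal_ne_zero.2 hκ.out.ne'
  have h0 : ∀ n, (waveFreq κ n : 𝕜) ≠ 0 := ofReal_waveFreq_ne_zero κ hκ.out
  have hcoord : ∀ n, waveBlock (waveFreq κ n) ν (modeDecomp 𝕜 κ f n) = modeDecomp 𝕜 κ g n ↔
      inner 𝕜 (sine 𝕜 (n + 1)) f.snd = inner 𝕜 (sine 𝕜 (n + 1)) (H10.toH1 𝕜 κ g.fst : L2 𝕜) ∧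
      -((κ : 𝕜) * inner 𝕜 (sineDeriv 𝕜 (n + 1)) (weakDeriv 𝕜 (H10.toH1 𝕜 κ f.fst))) =
        inner 𝕜 (sine 𝕜 (n + 1)) (g.snd + (ν : 𝕜) • f.snd) := by
    intro n
    rw [modeDecomp_apply, modeDecomp_apply, waveBlock_toLp, (WithLp.toLp_injective 2).eq_iff,
      Prod.mk.injEq, inner_modeH10 κ n g.fst, mul_right_inj' (h0 n), neg_mul,
      waveFreq_mul_inner_modeH10, inner_add_right, inner_smul_right, sub_eq_iff_eq_add]
  simp only [hcoord]
  constructor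
  · rintro ⟨d, rfl, rfl⟩ n
    rw [WaveDomain.incl_apply, waveAction_apply]
    refine ⟨rfl, ?_⟩
    have h := inner_closure_testPairs (hasWeakDeriv_second κ d.fst)
      (sine_mem_closure (𝕜 := 𝕜) (n + 1))
    change -((κ : 𝕜) * inner 𝕜 (sineDeriv 𝕜 (n + 1))
        (weakDeriv 𝕜 (H10.toH1 𝕜 κ (H2H10.toH10 𝕜 κ d.fst)))) =
      inner 𝕜 (sine 𝕜 (n + 1)) ((κ : 𝕜) • H2H10.second 𝕜 κ d.fst -
        (ν : 𝕜) • (H10.toH1 𝕜 κ d.snd : L2 𝕜) + (ν : 𝕜) • (H10.toH1 𝕜 κ d.snd : L2 𝕜))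
    rw [sub_add_cancel, inner_smul_right, h, mul_neg, neg_neg]
  · intro h
    have hv : f.snd = (H10.toH1 𝕜 κ g.fst : L2 𝕜) := by
      rw [← sub_eq_zero]
      refine eq_zero_of_inner_sine_eq_zero fun n hn => ?_
      obtain ⟨n, rfl⟩ := Nat.exists_eq_succ_of_ne_zero (Nat.one_le_iff_ne_zero.1 hn)
      rw [inner_sub_right, (h n).1, sub_self]
    obtain ⟨y, hy1, hy2⟩ := exists_H2H10_of_hasWeakDeriv κ (u := f.fst)
      (g := (κ : 𝕜)⁻¹ • (g.snd + (ν : 𝕜) • f.snd)) (hasWeakDeriv_of_inner_sine fun n => by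
        rw [inner_smul_right, ← (h n).2]
        field_simp)
    refine ⟨WithLp.toLp 2 (y, g.fst), ?_, ?_⟩
    · rw [WaveDomain.incl_apply]
      exact WithLp.ofLp_injective 2 (Prod.ext hy1 hv.symm)
    · rw [waveAction_apply]
      refine WithLp.ofLp_injective 2 (Prod.ext rfl ?_)
      change (κ : 𝕜) • H2H10.second 𝕜 κ y - (ν : 𝕜) • (H10.toH1 𝕜 κ g.fst : L2 𝕜) = g.snd
      rw [hy2, smul_inv_smul₀ hκ0, hv, add_sub_cancel_right]

omit hκ in
theorem waveOp_iff (ν : ℝ) (f g : Energy 𝕜 κ) :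
    (∃ h : f ∈ (waveOp 𝕜 κ ν).domain, waveOp 𝕜 κ ν ⟨f, h⟩ = g) ↔
      ∃ d, WaveDomain.incl 𝕜 κ d = f ∧ waveAction 𝕜 κ ν d = g := by
  constructor
  · rintro ⟨⟨d, rfl⟩, h⟩
    exact ⟨d, rfl, by rw [← h]; exact (waveOp_apply 𝕜 κ ν d).symm⟩
  · rintro ⟨d, rfl, rfl⟩
    exact ⟨⟨d, rfl⟩, waveOp_apply 𝕜 κ ν d⟩

theorem mem_opResolventSet_waveOp (ν : ℝ) {z : 𝕜} (hz : theta κ ν < RCLike.re z) :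
    z ∈ opResolventSet (waveOp 𝕜 κ ν) := by
  obtain ⟨C, hC, hN⟩ := exists_waveBlockResolvent_bound (tendsto_waveFreq κ hκ.out) ν z
  have h0 : ∀ n, z ^ 2 + ν * z + (waveFreq κ n : 𝕜) ^ 2 ≠ 0 := fun n =>
    charPoly_ne_zero hκ.out hz (Nat.succ_pos n) (waveFreq_sq κ hκ.out n)
  exact mem_opResolventSet_of_coord (modeDecomp 𝕜 κ)
    (fun f g => (waveOp_iff κ ν f g).trans (exists_waveAction_iff κ ν f g)) hC hN
    (fun n x => waveBlockResolvent_left (h0 n) x) (fun n x => waveBlockResolvent_right (h0 n) x)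

end Modes

/-! ### The norm of the domain -/

section DomainNorm
variable {𝕜 : Type*} [RCLike 𝕜] (κ : ℝ) [hκ : Fact (0 < κ)]

theorem norm_H2H10_sq (u : H2H10 𝕜 κ) :
    ‖u‖ ^ 2 = ‖H2H10.second 𝕜 κ u‖ ^ 2 + ‖H2H10.toH10 𝕜 κ u‖ ^ 2 :=
  WithLp.prod_norm_sq_eq_of_L2 (H2H10.jet 𝕜 κ u)

theorem norm_le_add_of_sq {a b c : ℝ} (hb : 0 ≤ b) (hc : 0 ≤ c) (h : a ^ 2 = b ^ 2 + c ^ 2) :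
    a ≤ b + c :=
  abs_le_of_sq_le_sq' (by nlinarith [mul_nonneg hb hc]) (by positivity) |>.2

theorem left_le_of_sq {a b c : ℝ} (ha : 0 ≤ a) (h : a ^ 2 = b ^ 2 + c ^ 2) : b ≤ a :=
  abs_le_of_sq_le_sq' (by nlinarith [sq_nonneg c]) ha |>.2

theorem right_le_of_sq {a b c : ℝ} (ha : 0 ≤ a) (h : a ^ 2 = b ^ 2 + c ^ 2) : c ≤ a :=
  abs_le_of_sq_le_sq' (by nlinarith [sq_nonneg b]) ha |>.2

theorem norm_incl_le (d : WaveDomain 𝕜 κ) :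
    ‖WaveDomain.incl 𝕜 κ d‖ ≤ (1 + 2 * (√κ)⁻¹) * ‖d‖ := by
  have hd := WithLp.prod_norm_sq_eq_of_L2 d
  have h1 := right_le_of_sq (norm_nonneg _) (norm_H2H10_sq κ d.fst)
  have h2 := norm_toH1_le κ d.snd
  have h3 := left_le_of_sq (norm_nonneg _) hd
  have h4 := right_le_of_sq (norm_nonneg _) hd
  have h5 : ‖WaveDomain.incl 𝕜 κ d‖ ≤
      ‖H2H10.toH10 𝕜 κ d.fst‖ + ‖(H10.toH1 𝕜 κ d.snd : L2 𝕜)‖ :=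
    norm_le_add_of_sq (norm_nonneg _) (norm_nonneg _)
      (WithLp.prod_norm_sq_eq_of_L2 (WaveDomain.incl 𝕜 κ d))
  have h6 : 2 * (√κ)⁻¹ * ‖d.snd‖ ≤ 2 * (√κ)⁻¹ * ‖d‖ := by gcongr
  linarith

theorem norm_waveAction_le {ν : ℝ} (hν : 0 < ν) (d : WaveDomain 𝕜 κ) :
    ‖waveAction 𝕜 κ ν d‖ ≤ (1 + κ + ν * (2 * (√κ)⁻¹)) * ‖d‖ := by
  have hκ0 := hκ.out
  have hd := WithLp.prod_norm_sq_eq_of_L2 d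
  have h1 := left_le_of_sq (norm_nonneg _) (norm_H2H10_sq κ d.fst)
  have h2 := norm_toH1_le κ d.snd
  have h3 := left_le_of_sq (norm_nonneg _) hd
  have h4 := right_le_of_sq (norm_nonneg _) hd
  have h5 : ‖waveAction 𝕜 κ ν d‖ ≤ ‖d.snd‖ +
      ‖(κ : 𝕜) • H2H10.second 𝕜 κ d.fst - (ν : 𝕜) • (H10.toH1 𝕜 κ d.snd : L2 𝕜)‖ :=
    norm_le_add_of_sq (norm_nonneg _) (norm_nonneg _)
      (WithLp.prod_norm_sq_eq_of_L2 (waveAction 𝕜 κ ν d))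
  have h6 := norm_sub_le ((κ : 𝕜) • H2H10.second 𝕜 κ d.fst)
    ((ν : 𝕜) • (H10.toH1 𝕜 κ d.snd : L2 𝕜))
  rw [norm_smul, norm_smul, RCLike.norm_ofReal, RCLike.norm_ofReal, abs_of_pos hκ0,
    abs_of_pos hν] at h6
  have h7 : κ * ‖H2H10.second 𝕜 κ d.fst‖ ≤ κ * ‖d‖ := by gcongr; linarith
  have h8 : ν * ‖(H10.toH1 𝕜 κ d.snd : L2 𝕜)‖ ≤ ν * (2 * (√κ)⁻¹ * ‖d‖) := by
    gcongr
    refine h2.trans ?_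
    gcongr
  linarith

omit hκ in
/-- Integration by parts gives
`‖u'‖² = -⟪u, u''⟫`, so that the Poincaré inequality bounds `u'` by
`u''`. -/
theorem norm_weakDeriv_le_second (u : H2H10 𝕜 κ) :
    ‖weakDeriv 𝕜 (H10.toH1 𝕜 κ (H2H10.toH10 𝕜 κ u))‖ ≤ 2 * ‖H2H10.second 𝕜 κ u‖ := by
  set w := H2H10.toH10 𝕜 κ u with hw
  have h1 := inner_weakDeriv_H10 κ (hasWeakDeriv_second κ u) w
  have h2 : ‖weakDeriv 𝕜 (H10.toH1 𝕜 κ w)‖ ^ 2 ≤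
      2 * ‖weakDeriv 𝕜 (H10.toH1 𝕜 κ w)‖ * ‖H2H10.second 𝕜 κ u‖ := by
    rw [← inner_self_eq_norm_sq (𝕜 := 𝕜), h1]
    refine (RCLike.re_le_norm _).trans ?_
    rw [norm_neg]
    refine (norm_inner_le_norm _ _).trans ?_
    gcongr
    exact poincare _ w.2
  rcases (norm_nonneg (weakDeriv 𝕜 (H10.toH1 𝕜 κ w))).eq_or_lt with h | h
  · rw [← h]; positivity
  · nlinarith

/-- The norm of the domain is controlled by the graph norm of the damped-wave operator, and in fact
by `‖U d‖` alone. -/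
theorem exists_norm_le_waveAction {ν : ℝ} (hν : 0 < ν) :
    ∃ C : ℝ, ∀ d : WaveDomain 𝕜 κ, ‖d‖ ≤ C * ‖waveAction 𝕜 κ ν d‖ := by
  refine ⟨1 + (1 + 2 * √κ) * (κ⁻¹ * (1 + ν * (2 * (√κ)⁻¹))), fun d => ?_⟩
  have hκ0 := hκ.out
  set a := ‖waveAction 𝕜 κ ν d‖ with ha
  have hi := WithLp.prod_norm_sq_eq_of_L2 (waveAction 𝕜 κ ν d)
  have h1 : ‖d.snd‖ ≤ a := left_le_of_sq (norm_nonneg _) hi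
  have h2 : ‖(κ : 𝕜) • H2H10.second 𝕜 κ d.fst - (ν : 𝕜) • (H10.toH1 𝕜 κ d.snd : L2 𝕜)‖ ≤ a :=
    right_le_of_sq (norm_nonneg _) hi
  have h3 : κ * ‖H2H10.second 𝕜 κ d.fst‖ ≤ (1 + ν * (2 * (√κ)⁻¹)) * a := by
    have h4 := norm_sub_norm_le ((κ : 𝕜) • H2H10.second 𝕜 κ d.fst)
      ((ν : 𝕜) • (H10.toH1 𝕜 κ d.snd : L2 𝕜))
    rw [norm_smul, norm_smul, RCLike.norm_ofReal, RCLike.norm_ofReal, abs_of_pos hκ0,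
      abs_of_pos hν] at h4
    have h5 : ν * ‖(H10.toH1 𝕜 κ d.snd : L2 𝕜)‖ ≤ ν * (2 * (√κ)⁻¹ * a) := by
      gcongr
      refine (norm_toH1_le κ d.snd).trans ?_
      gcongr
    linarith
  have h6 : ‖H2H10.second 𝕜 κ d.fst‖ ≤ κ⁻¹ * (1 + ν * (2 * (√κ)⁻¹)) * a := by
    rw [mul_assoc, ← div_eq_inv_mul, le_div_iff₀ hκ0]
    linarith
  have h7 : ‖H2H10.toH10 𝕜 κ d.fst‖ ≤ √κ * (2 * ‖H2H10.second 𝕜 κ d.fst‖) := by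
    rw [norm_H10]
    gcongr
    exact norm_weakDeriv_le_second κ d.fst
  have h8 := norm_le_add_of_sq (norm_nonneg _) (norm_nonneg _) (norm_H2H10_sq κ d.fst)
  have h9 := norm_le_add_of_sq (norm_nonneg _) (norm_nonneg _) (WithLp.prod_norm_sq_eq_of_L2 d)
  have h10 : (1 + 2 * √κ) * ‖H2H10.second 𝕜 κ d.fst‖ ≤
      (1 + 2 * √κ) * (κ⁻¹ * (1 + ν * (2 * (√κ)⁻¹)) * a) := by gcongr
  linarith

end DomainNorm

end DampedWave

theorem mainTheorem3 {𝕜 : Type*} [RCLike 𝕜] (κ ν : ℝ) [Fact (0 < κ)] (hν : 0 < ν) :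
    (waveOp 𝕜 κ ν).IsClosed ∧
    {z : 𝕜 | theta κ ν < RCLike.re z} ⊆ opResolventSet (waveOp 𝕜 κ ν) ∧
    {z : 𝕜 | RCLike.re z = 0} ⊆ opResolventSet (waveOp 𝕜 κ ν) ∧
    ∃ T : ℝ → Energy 𝕜 κ →L[𝕜] Energy 𝕜 κ,
      IsContractionSemigroup T ∧
      IsGenerator (waveOp 𝕜 κ ν) T ∧
      (∀ T₀ : ℝ, 0 < T₀ → ∀ (F₀ : WaveDomain 𝕜 κ) (F₁ : ℝ → WaveDomain 𝕜 κ),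
        ContinuousOn F₁ (Icc 0 T₀) →
        (∀ t ∈ Icc 0 T₀, IntervalIntegrable
          (fun s => T (t - s) (WaveDomain.incl 𝕜 κ (F₁ s))) volume 0 t) ∧
        ∃ V : ℝ → WaveDomain 𝕜 κ,
          (∀ t ∈ Icc 0 T₀, WaveDomain.incl 𝕜 κ (V t) = T t (WaveDomain.incl 𝕜 κ F₀) +
            ∫ s in (0 : ℝ)..t, T (t - s) (WaveDomain.incl 𝕜 κ (F₁ s))) ∧
          ContinuousOn V (Icc 0 T₀) ∧
          (∀ t ∈ Ioc 0 T₀, HasDerivWithinAt (fun r => WaveDomain.incl 𝕜 κ (V r))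
            (waveOp 𝕜 κ ν (WaveDomain.toDomain 𝕜 κ ν (V t)) + WaveDomain.incl 𝕜 κ (F₁ t))
            (Icc 0 T₀) t) ∧
          V 0 = F₀) ∧
      ∃ TD : ℝ → WaveDomain 𝕜 κ →L[𝕜] WaveDomain 𝕜 κ,
        (∀ t : ℝ, 0 ≤ t → ∀ f : WaveDomain 𝕜 κ,
          WaveDomain.incl 𝕜 κ (TD t f) = T t (WaveDomain.incl 𝕜 κ f)) ∧
        Tendsto (fun t => ‖TD t‖) atTop (𝓝 0) ∧
        ∃ ω : ℝ, ∀ t : ℝ, 0 ≤ t → ‖TD t‖ ≤ ω := by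
  have hκ : 0 < κ := Fact.out
  have hD := exists_waveAction_iff (𝕜 := 𝕜) κ ν
  have hA := fun f g => (waveOp_iff (𝕜 := 𝕜) κ ν f g).trans (hD f g)
  have hM : ∀ (n : ℕ) (t : ℝ), 0 ≤ t → ‖expFlow (waveBlock (𝕜 := 𝕜) (waveFreq κ n) ν) t‖ ≤ 1 :=
    fun n t ht => norm_expFlow_waveBlock_le_one _ hν ht
  have himag : {z : 𝕜 | RCLike.re z = 0} ⊆ opResolventSet (waveOp 𝕜 κ ν) := fun z hz =>
    mem_opResolventSet_waveOp κ ν (by rw [show RCLike.re z = 0 from hz]; exact theta_neg hκ hν)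
  -- `B` is the operator as a map from its domain with the norm of `D(U)`, and `S` its inverse.
  set J : WaveDomain 𝕜 κ →L[𝕜] Energy 𝕜 κ :=
    LinearMap.mkContinuous (WaveDomain.incl 𝕜 κ) _ (norm_incl_le κ) with hJ
  set B : WaveDomain 𝕜 κ →L[𝕜] Energy 𝕜 κ :=
    LinearMap.mkContinuous (waveAction 𝕜 κ ν) _ (norm_waveAction_le κ hν) with hB
  obtain ⟨C, hC⟩ := exists_norm_le_waveAction (𝕜 := 𝕜) κ hν
  have hinj : Function.Injective (waveAction 𝕜 κ ν) := by
    rw [injective_iff_map_eq_zero]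
    intro d hd
    have := hC d
    rw [hd, norm_zero, mul_zero] at this
    exact norm_le_zero_iff.1 this
  have hsurj : Function.Surjective (waveAction 𝕜 κ ν) := by
    obtain ⟨R, -, hR⟩ := himag (show RCLike.re (0 : 𝕜) = 0 from map_zero _)
    intro g
    obtain ⟨h, h'⟩ := hR (-g)
    rw [zero_smul, zero_sub, neg_inj] at h'
    obtain ⟨d, -, hd⟩ := (waveOp_iff κ ν _ _).1 ⟨h, h'⟩
    exact ⟨d, hd⟩
  set e := LinearEquiv.ofBijective (waveAction 𝕜 κ ν) ⟨hinj, hsurj⟩ with he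
  have heB : ∀ g, waveAction 𝕜 κ ν (e.symm g) = g := fun g => e.apply_symm_apply g
  set S : Energy 𝕜 κ →L[𝕜] WaveDomain 𝕜 κ :=
    LinearMap.mkContinuous e.symm.toLinearMap C (fun g => by
      have := hC (e.symm g)
      rwa [heB] at this) with hS
  have hSB : ∀ d, S (B d) = d := fun d => e.symm_apply_apply d
  have hBS : ∀ g, B (S g) = g := heB
  set T := blockSemigroup (modeDecomp 𝕜 κ) _ hM with hT
  refine ⟨isClosed_of_coord (modeDecomp 𝕜 κ) hA, fun z hz => mem_opResolventSet_waveOp κ ν hz,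
    himag, T, isContractionSemigroup_blockSemigroup _ hM,
    isGenerator_blockSemigroup _ hM hA, fun T₀ hT₀ F₀ F₁ hF₁ => ?_,
    fun t => S ∘L T t ∘L B, fun t ht d => ?_, ?_, ?_⟩
  · have h := exists_classical_solution (modeDecomp 𝕜 κ) hM (J := J) (B := B) hD hSB hBS hT₀ F₀ hF₁
    simpa only [waveOp_apply] using! h
  · exact blockSemigroup_domain (modeDecomp 𝕜 κ) hM (J := J) (B := B) hD hSB ht d
  · obtain ⟨δ, hδ, hdecay⟩ :=
      exists_norm_expFlow_waveBlock_le (𝕜 := 𝕜) hν (waveFreq_pos κ hκ 0)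
    have hexp : Tendsto (fun t : ℝ => ‖S‖ * (2 * Real.exp (-δ * t) * ‖B‖)) atTop (𝓝 0) := by
      have h1 : Tendsto (fun t : ℝ => Real.exp (-δ * t)) atTop (𝓝 0) :=
        Real.tendsto_exp_atBot.comp (tendsto_id.const_mul_atTop_of_neg (neg_neg_of_pos hδ))
      simpa using (((h1.const_mul 2).mul_const ‖B‖).const_mul ‖S‖)
    refine squeeze_zero' (Eventually.of_forall fun t => norm_nonneg _) ?_ hexp
    filter_upwards [eventually_ge_atTop 0] with t ht
    refine (ContinuousLinearMap.opNorm_comp_le _ _).trans ?_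
    gcongr
    refine (ContinuousLinearMap.opNorm_comp_le _ _).trans ?_
    gcongr
    exact norm_blockSemigroup_le _ hM ht (by positivity) fun n =>
      hdecay _ (waveFreq_zero_le κ n) t ht
  · refine ⟨‖S‖ * (1 * ‖B‖), fun t _ => ?_⟩
    refine (ContinuousLinearMap.opNorm_comp_le _ _).trans ?_
    gcongr
    refine (ContinuousLinearMap.opNorm_comp_le _ _).trans ?_
    gcongr
    exact norm_blockSemigroup_le_one _ hM t
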